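/- Let $X$ be a separable complex Banach space and let $(T_t)_{t\ge 0}$ be a $C_0$-semigroup of bounded linear operators on $X$ with infinitesimal generator $A$. Assume that there is a family $(f_j)_{j\in\Gamma}$ of locally bounded measurable maps $f_j\colon I_j\to X$, where each $I_j\subseteq\mathbb{R}$ is an interval with more than one point, such that $f_j(t)\in D(A)$ and $Af_j(t)=it\,f_j(t)$ for every $t\in I_j$ and $j\in\Gamma$, and such that $\operatorname{span}\{f_j(t) : j\in\Gamma,\ t\in I_j\}$ is dense in $X$. Suppose that either (a) $f_j\in C^2(I_j,X)$ for every $j\in\Gamma$, or (b) $X$ does not contain $c_0$ (that is, $X$ has no closed subspace isomorphic to $c_0$), and $\langle\varphi,f_j\rangle\in C^1(I_j)$ for every $\varphi\in X'$ and every $j\in\Gamma$. Then there is a Borel probability measure $\mu$ on $X$ that is invariant, $\mu(T_t^{-1}(B))=\mu(B)$ for all $t\ge 0$ and all Borel sets $B\subseteq X$; strongly mixing, $\lim_{t\to\infty}\mu(B\cap T_t^{-1}(C))=\mu(B)\mu(C)$ for all Borel sets $B,C\subseteq X$; and has full support, $\mu(U)>0$ for every non-empty open set $U\subseteq X$. (At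 an endpoint of $I_j$ that belongs to $I_j$, differentiability is one-sided.) -/

import Mathlib

open Filter Topology MeasureTheory
open scoped NNReal ZeroAtInfty

namespace SemigroupMixing

/-- A family `(T t)_{t ≥ 0}` of bounded operators is a `C₀`-semigroup: `T 0 = I`,
`T (t + s) = T t ∘ T s`, and `T s x → T t x` as `s → t`, for all `x` and `t ≥ 0`. -/
structure IsC0Semigroup {X : Type*} [NormedAddCommGroup X] [NormedSpace ℂ X]
    (T : ℝ≥0 → X →L[ℂ] X) : Prop where
  map_zero : T 0 = ContinuousLinearMap.id ℂ X
  map_add : ∀ t s : ℝ≥0, T (t + s) = (T t).comp (T s)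
  tendsto : ∀ (x : X) (t : ℝ≥0), Tendsto (fun s => T s x) (𝓝 t) (𝓝 (T t x))

/-- `y = lim_{t → 0⁺} (T t x - x) / t`. -/
def HasGeneratorValue {X : Type*} [NormedAddCommGroup X] [NormedSpace ℂ X]
    (T : ℝ≥0 → X →L[ℂ] X) (x y : X) : Prop :=
  Tendsto (fun t : ℝ≥0 => ((t : ℝ) : ℂ)⁻¹ • (T t x - x)) (𝓝[>] 0) (𝓝 y)

theorem HasGeneratorValue.unique {X : Type*} [NormedAddCommGroup X] [NormedSpace ℂ X]
    {T : ℝ≥0 → X →L[ℂ] X} {x y z : X} (hy : HasGeneratorValue T x y)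
    (hz : HasGeneratorValue T x z) : y = z :=
  tendsto_nhds_unique hy hz

theorem HasGeneratorValue.add {X : Type*} [NormedAddCommGroup X] [NormedSpace ℂ X]
    {T : ℝ≥0 → X →L[ℂ] X} {x x' y y' : X} (h : HasGeneratorValue T x y)
    (h' : HasGeneratorValue T x' y') : HasGeneratorValue T (x + x') (y + y') := by
  refine (Tendsto.add h h').congr fun t => ?_
  rw [_root_.map_add, ← smul_add]
  congr 1
  abel

theorem HasGeneratorValue.smul {X : Type*} [NormedAddCommGroup X] [NormedSpace ℂ X]
    {T : ℝ≥0 → X →L[ℂ] X} {x y : X} (c : ℂ) (h : HasGeneratorValue T x y) :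
    HasGeneratorValue T (c • x) (c • y) := by
  refine (Tendsto.const_smul h c).congr fun t => ?_
  rw [_root_.map_smul, ← smul_sub, smul_comm]

theorem HasGeneratorValue.zero {X : Type*} [NormedAddCommGroup X] [NormedSpace ℂ X]
    (T : ℝ≥0 → X →L[ℂ] X) : HasGeneratorValue T 0 0 := by
  simp [HasGeneratorValue]

/-- The infinitesimal generator of `(T t)`: the partially defined linear operator
`A x = lim_{t → 0⁺} (T t x - x) / t`, whose domain is the set of all `x` for which
this limit exists in norm. -/
noncomputable def generator {X : Type*} [NormedAddCommGroup X] [NormedSpace ℂ X]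
    (T : ℝ≥0 → X →L[ℂ] X) : X →ₗ.[ℂ] X where
  domain :=
    { carrier := {x | ∃ y, HasGeneratorValue T x y}
      add_mem' := fun ⟨y, hy⟩ ⟨y', hy'⟩ => ⟨y + y', hy.add hy'⟩
      zero_mem' := ⟨0, HasGeneratorValue.zero T⟩
      smul_mem' := fun c _ ⟨y, hy⟩ => ⟨c • y, hy.smul c⟩ }
  toFun :=
    { toFun := fun x => Classical.choose x.2
      map_add' := fun x x' => (Classical.choose_spec (x + x').2).unique
        ((Classical.choose_spec x.2).add (Classical.choose_spec x'.2))
      map_smul' := fun c x => (Classical.choose_spec (c • x).2).unique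
        ((Classical.choose_spec x.2).smul c) }

/-- `X` contains (a closed subspace isomorphic to) `c₀`: there is a bounded linear map from
`c₀`, the space of complex null sequences with the sup norm, into `X` that is bounded below. -/
def ContainsC0 (X : Type*) [NormedAddCommGroup X] [NormedSpace ℂ X] : Prop :=
  ∃ (J : C₀(ℕ, ℂ) →L[ℂ] X) (K : ℝ≥0), AntilipschitzWith K J

/-- `f` is locally bounded on `s`: every point of `s` has a neighbourhood `U` such that `f` is
bounded on `U ∩ s`. -/
def LocallyBoundedOn {X : Type*} [NormedAddCommGroup X] (f : ℝ → X) (s : Set ℝ) : Prop :=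
  ∀ t ∈ s, ∃ U ∈ 𝓝 t, Bornology.IsBounded (f '' (U ∩ s))

/-- `μ` is invariant under every `T t`. -/
def IsInvariant {X : Type*} [NormedAddCommGroup X] [NormedSpace ℂ X] [MeasurableSpace X]
    (T : ℝ≥0 → X →L[ℂ] X) (μ : Measure X) : Prop :=
  ∀ t : ℝ≥0, MeasurePreserving (T t) μ μ

/-- Strong mixing: `μ (A ∩ (T t)⁻¹ B) → μ A * μ B` as `t → ∞`, for all measurable `A`, `B`. -/
def IsStronglyMixing {X : Type*} [NormedAddCommGroup X] [NormedSpace ℂ X] [MeasurableSpace X]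
    (T : ℝ≥0 → X →L[ℂ] X) (μ : Measure X) : Prop :=
  ∀ A B : Set X, MeasurableSet A → MeasurableSet B →
    Tendsto (fun t : ℝ≥0 => μ (A ∩ T t ⁻¹' B)) atTop (𝓝 (μ A * μ B))

/-- Full support: every non-empty open set has positive measure. -/
def HasFullSupport {X : Type*} [TopologicalSpace X] [MeasurableSpace X] (μ : Measure X) : Prop :=
  ∀ U : Set X, IsOpen U → U.Nonempty → 0 < μ U

end SemigroupMixing

/-!
The measure is a Gaussian measure. Since `A f_j(s) = i s f_j(s)`, the semigroup acts on the vectors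
`f_j(s)` by the unimodular factors `exp (i s t)` (`IsC0Semigroup.apply_eq_exp_smul`). For an
interval `[p, q]` in the interior of `I_j` and a polynomial cutoff `ψ` vanishing at `p` and `q`, put
`h = ψ • f_j` and let `v n` be the Fourier coefficients of `h` on `[p, q]`. The law of the random
series `∑ ε γ n v n`, summed over countably many such blocks with small factors `ε` and independent
complex Gaussians `γ n`, has by Parseval's identity a characteristic functional given by the
variance `φ ↦ ∑ ε² (q - p)⁻¹ ∫ |φ (h s)|² ds`, the sum running over the blocks
(`exists_mixing_measure`).

* Replacing `φ` by `φ ∘ T t` multiplies `φ ∘ h` by `exp (i s t)`, which does not change the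
  variance; since characteristic functionals determine measures, the law is invariant.
* The variance of `φ + χ ∘ T t` tends to the sum of the variances of `φ` and `χ` by the
  Riemann–Lebesgue lemma. As trigonometric polynomials are dense in `L²(μ)`, this gives strong
  mixing (`isStronglyMixing_of_tendsto_charFunDual`).
* The law is quasi-invariant under translation by the vectors `v n`. These have dense span, so that
  every non-empty open set is charged (`hasFullSupport_of_charFunDual_eq`).

It remains to see that the random series converges. Almost surely `|γ n| ≤ C (1 + |n|) ^ (1/4)`
(within one block), so it suffices that all bounded multiples of `(1 + |n|) ^ (1/4) v n` are
summable. If `f_j` is `C²`, then `‖v n‖ = O(n⁻²)`. If it is only weakly `C¹`, then `(n φ (v n))` is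
square summable for every functional `φ`, hence `(1 + |n|) ^ (1/4) |φ (v n)|` is summable; in a
space without `c₀` the theorem of Bessaga and Pełczyński (`MultiplierBounded.summable_smul`) turns
this into summability in norm. That theorem is derived from Rosenthal's disjointification lemma.
-/

/-! ### Weakly unconditionally summable families and `c₀` -/

namespace SemigroupMixing

/-- All finite sums `∑ aₘ uₘ` with `|aₘ| ≤ 1` are bounded in norm by `C`. This is the quantitative
form of weak unconditional summability. -/
def MultiplierBounded {M X : Type*} [NormedAddCommGroup X] [NormedSpace ℂ X]
    (u : M → X) (C : ℝ) : Prop :=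
  ∀ (F : Finset M) (a : M → ℂ), (∀ m, ‖a m‖ ≤ 1) → ‖∑ m ∈ F, a m • u m‖ ≤ C

open scoped ENNReal in
/-- Rosenthal's disjointification lemma. The induction is on the bound `N * ε` for the row sums:
either one of the infinitely many pieces of a partition of the index set already works, or a bad row
can be chosen in each of them, and among the chosen rows the row sums have dropped by `ε`. -/
theorem exists_injective_tsum_le (a : ℕ → ℕ → ℝ≥0∞) {ε : ℝ≥0∞} (hε : ε ≠ ∞) (N : ℕ) :
    ∀ σ : ℕ → ℕ, σ.Injective → (∀ k, ∑' l, a (σ k) (σ l) ≤ N * ε) →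
      ∃ τ : ℕ → ℕ, τ.Injective ∧ ∀ k, ∑' l, (if l = k then 0 else a (τ k) (τ l)) ≤ ε := by
  induction N with
  | zero =>
    intro σ hσ h
    refine ⟨σ, hσ, fun k => ?_⟩
    refine le_trans (ENNReal.tsum_le_tsum fun l => ?_) ((h k).trans (by simp))
    split_ifs <;> simp
  | succ N ih =>
    intro σ hσ h
    by_cases hp : ∃ p : ℕ, ∀ k, ∑' l, (if l = k then 0 else
        a (σ (Nat.pair p k)) (σ (Nat.pair p l))) ≤ ε
    · obtain ⟨p, hp⟩ := hp
      exact ⟨fun k => σ (Nat.pair p k), fun k l hkl => (Nat.pair_eq_pair.1 (hσ hkl)).2, hp⟩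
    · push Not at hp
      choose κ hκ using hp
      have hinj : Function.Injective fun p => Nat.pair p (κ p) :=
        fun p q hpq => (Nat.pair_eq_pair.1 hpq).1
      refine ih (fun p => σ (Nat.pair p (κ p))) (hσ.comp hinj) fun p => ?_
      have hsplit : ∑' q, a (σ (Nat.pair p (κ p))) (σ (Nat.pair q (κ q))) +
          ∑' l, (if l = κ p then 0 else a (σ (Nat.pair p (κ p))) (σ (Nat.pair p l))) ≤
          ∑' l, a (σ (Nat.pair p (κ p))) (σ l) := by
        set b : ℕ → ℝ≥0∞ := fun l => a (σ (Nat.pair p (κ p))) (σ l) with hb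
        have hinj2 : Function.Injective fun l => Nat.pair p l :=
          fun l l' hl => (Nat.pair_eq_pair.1 hl).2
        have h1 : ∑' q, b (Nat.pair q (κ q)) =
            ∑' l, (Set.range fun p => Nat.pair p (κ p)).indicator b l := by
          rw [← tsum_subtype, tsum_range b hinj]
        have h2 : ∑' l, (if l = κ p then 0 else b (Nat.pair p l)) =
            ∑' l, ((Nat.pair p) '' {l | l ≠ κ p}).indicator b l := by
          rw [← tsum_subtype, tsum_image b hinj2.injOn, tsum_subtype {l | l ≠ κ p}
            (fun l => b (Nat.pair p l))]
          refine tsum_congr fun l => ?_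
          by_cases hl : l = κ p <;> simp [hl]
        rw [h1, h2, ← ENNReal.tsum_add]
        refine ENNReal.tsum_le_tsum fun l => ?_
        have hdisj : Disjoint (Set.range fun p => Nat.pair p (κ p))
            ((Nat.pair p) '' {l | l ≠ κ p}) := by
          rw [Set.disjoint_left]
          rintro _ ⟨q, rfl⟩ ⟨l, hl, hql⟩
          obtain ⟨rfl, rfl⟩ := Nat.pair_eq_pair.1 hql
          exact hl rfl
        calc _ = ((Set.range fun p => Nat.pair p (κ p)) ∪
              ((Nat.pair p) '' {l | l ≠ κ p})).indicator b l := by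
                rw [Set.indicator_union_of_disjoint hdisj]
          _ ≤ b l := Set.indicator_le_self _ _ _
      have hbound := hsplit.trans (h (Nat.pair p (κ p)))
      rw [Nat.cast_succ, add_mul, one_mul] at hbound
      refine (ENNReal.add_le_add_iff_right hε).1 (le_trans ?_ hbound)
      gcongr
      exact (hκ p).le

section Multiplier

variable {M X : Type*} [NormedAddCommGroup X] [NormedSpace ℂ X]

theorem MultiplierBounded.norm_sum_le {u : M → X} {C : ℝ} (hu : MultiplierBounded u C)
    (F : Finset M) (a : M → ℂ) {r : ℝ} (hr : 0 ≤ r) (ha : ∀ m ∈ F, ‖a m‖ ≤ r) :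
    ‖∑ m ∈ F, a m • u m‖ ≤ r * C := by
  classical
  rcases hr.eq_or_lt with rfl | hr
  · have : ∑ m ∈ F, a m • u m = 0 := Finset.sum_eq_zero fun m hm => by
      rw [norm_le_zero_iff.1 (ha m hm), zero_smul]
    simp [this]
  · have h := hu F (fun m => if m ∈ F then (r : ℂ)⁻¹ * a m else 0) fun m => by
      split_ifs with hm
      · rw [norm_mul, norm_inv, Complex.norm_real, Real.norm_of_nonneg hr.le, inv_mul_le_iff₀ hr]
        simpa using ha m hm
      · simp
    have h2 : ∑ m ∈ F, a m • u m =
        (r : ℂ) • ∑ m ∈ F, (if m ∈ F then (r : ℂ)⁻¹ * a m else 0) • u m := by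
      rw [Finset.smul_sum]
      refine Finset.sum_congr rfl fun m hm => ?_
      rw [if_pos hm, smul_smul, mul_inv_cancel_left₀ (by exact_mod_cast hr.ne')]
    rw [h2, norm_smul, Complex.norm_real, Real.norm_of_nonneg hr.le]
    gcongr

theorem MultiplierBounded.nonneg {u : M → X} {C : ℝ} (hu : MultiplierBounded u C) : 0 ≤ C := by
  simpa using hu ∅ 0 (by simp)

theorem MultiplierBounded.sum_norm_dual_le {u : M → X} {C : ℝ} (hu : MultiplierBounded u C)
    (φ : StrongDual ℂ X) (F : Finset M) : ∑ m ∈ F, ‖φ (u m)‖ ≤ ‖φ‖ * C := by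
  have hph : ∀ z : ℂ, ∃ c : ℂ, ‖c‖ ≤ 1 ∧ c * z = ‖z‖ := by
    intro z
    rcases eq_or_ne z 0 with rfl | hz
    · exact ⟨0, by simp, by simp⟩
    · have : (‖z‖ : ℂ) ≠ 0 := by simpa using hz
      exact ⟨‖z‖ / z, by simp [hz], by field_simp⟩
  choose c hc hcz using hph
  have h1 : ((∑ m ∈ F, ‖φ (u m)‖ : ℝ) : ℂ) = φ (∑ m ∈ F, c (φ (u m)) • u m) := by
    simp [map_sum, hcz]
  have h2 : ∑ m ∈ F, ‖φ (u m)‖ = ‖φ (∑ m ∈ F, c (φ (u m)) • u m)‖ := by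
    rw [← h1, Complex.norm_real, Real.norm_of_nonneg (by positivity)]
  rw [h2]
  exact (φ.le_opNorm _).trans (by gcongr; exact hu F _ fun m => hc _)

theorem MultiplierBounded.blocks {u : M → X} {C : ℝ} (hu : MultiplierBounded u C)
    {F : ℕ → Finset M} (hF : Pairwise fun i j => Disjoint (F i) (F j)) :
    MultiplierBounded (fun k => ∑ m ∈ F k, u m) C := by
  classical
  intro G a ha
  have : ∑ k ∈ G, a k • ∑ m ∈ F k, u m =
      ∑ m ∈ G.biUnion F, (if h : ∃ k, m ∈ F k then a h.choose else 0) • u m := by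
    rw [Finset.sum_biUnion fun i _ j _ hij => hF hij]
    refine Finset.sum_congr rfl fun k _ => ?_
    rw [Finset.smul_sum]
    refine Finset.sum_congr rfl fun m hm => ?_
    have h : ∃ k, m ∈ F k := ⟨k, hm⟩
    have hk : h.choose = k := by
      by_contra hne
      exact Finset.disjoint_left.1 (hF hne) h.choose_spec hm
    rw [dif_pos h, hk]
  rw [this]
  refine hu _ _ fun m => ?_
  split_ifs
  · exact ha _
  · simp

theorem MultiplierBounded.comp_injective {N : Type*} {u : M → X} {C : ℝ}
    (hu : MultiplierBounded u C) {τ : N → M} (hτ : τ.Injective) :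
    MultiplierBounded (u ∘ τ) C := by
  classical
  intro G a ha
  have h := hu (G.map ⟨τ, hτ⟩) (Function.extend τ a 0) fun m => by
    by_cases hm : ∃ k, τ k = m
    · obtain ⟨k, rfl⟩ := hm
      rw [hτ.extend_apply]; exact ha k
    · rw [Function.extend_apply' _ _ _ hm]; simp
  simpa [hτ.extend_apply] using h

/-- A family that is weakly absolutely summable is multiplier bounded, by the uniform boundedness
principle in the dual space. -/
theorem exists_multiplierBounded {u : M → X}
    (hu : ∀ φ : StrongDual ℂ X, Summable fun m => ‖φ (u m)‖) : ∃ C, MultiplierBounded u C := by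
  let ι := {p : Finset M × (M → ℂ) // ∀ m, ‖p.2 m‖ ≤ 1}
  obtain ⟨C, hC⟩ := banach_steinhaus (𝕜 := ℂ) (𝕜₂ := ℂ) (σ₁₂ := RingHom.id ℂ) (ι := ι)
    (g := fun p => NormedSpace.inclusionInDoubleDual ℂ X (∑ m ∈ p.1.1, p.1.2 m • u m)) fun φ => by
      refine ⟨∑' m, ‖φ (u m)‖, fun p => ?_⟩
      rw [NormedSpace.dual_def, map_sum]
      refine (norm_sum_le _ _).trans (le_trans (Finset.sum_le_sum fun m _ => ?_)
        ((hu φ).sum_le_tsum p.1.1 fun _ _ => norm_nonneg _))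
      rw [_root_.map_smul, norm_smul]
      exact mul_le_of_le_one_left (norm_nonneg _) (p.2 m)
  refine ⟨C, fun F a ha => ?_⟩
  have := hC ⟨(F, a), ha⟩
  rwa [show ‖NormedSpace.inclusionInDoubleDual ℂ X (∑ m ∈ F, a m • u m)‖ = _ from
    (NormedSpace.inclusionInDoubleDualLi ℂ).norm_map _] at this

variable [CompleteSpace X]

theorem MultiplierBounded.summable_of_tendsto {u : ℕ → X} {C : ℝ} (hu : MultiplierBounded u C)
    {x : ℕ → ℂ} (hx : Tendsto x cofinite (𝓝 0)) : Summable fun k => x k • u k := by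
  have hC := hu.nonneg
  rw [summable_iff_vanishing_norm]
  intro ε hε
  have hr : 0 < ε / (C + 1) := by positivity
  have hfin : {k | ¬ ‖x k‖ < ε / (C + 1)}.Finite := by
    have := (tendsto_zero_iff_norm_tendsto_zero.1 hx).eventually_lt_const hr
    exact this
  refine ⟨hfin.toFinset, fun t ht => ?_⟩
  refine (hu.norm_sum_le t x hr.le fun m hm => ?_).trans_lt ?_
  · have := Finset.disjoint_left.1 ht hm
    simp only [Set.Finite.mem_toFinset, Set.mem_ofPred_eq, not_not] at this
    exact this.le
  · rw [div_mul_eq_mul_div, div_lt_iff₀ (by positivity)]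
    nlinarith

/-- A multiplier bounded sequence that is bounded away from zero spans a copy of `c₀`, up to
passing to a subsequence: by Rosenthal's lemma, the norming functionals of the terms become almost
biorthogonal to the terms along a subsequence. -/
theorem MultiplierBounded.containsC0 {u : ℕ → X} {C : ℝ} (hu : MultiplierBounded u C) {δ : ℝ}
    (hδ : 0 < δ) (hδu : ∀ k, δ ≤ ‖u k‖) : ContainsC0 X := by
  have hC := hu.nonneg
  choose φ hφ1 hφ using fun k => exists_dual_vector'' ℂ (u k)
  have hrow : ∀ k, ∑' l, ENNReal.ofReal ‖φ k (u l)‖ ≤ ENNReal.ofReal C := by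
    intro k
    refine ENNReal.tsum_le_of_sum_range_le fun n => ?_
    rw [← ENNReal.ofReal_sum_of_nonneg fun _ _ => norm_nonneg _]
    refine ENNReal.ofReal_le_ofReal ((hu.sum_norm_dual_le (φ k) _).trans ?_)
    exact mul_le_of_le_one_left hC (hφ1 k)
  obtain ⟨N, hN⟩ := exists_nat_ge (C / (δ / 2))
  obtain ⟨τ, hτ, hτs⟩ := exists_injective_tsum_le (fun k l => ENNReal.ofReal ‖φ k (u l)‖)
    (ε := ENNReal.ofReal (δ / 2)) ENNReal.ofReal_ne_top N id Function.injective_id fun k => by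
      refine (hrow k).trans ?_
      rw [← ENNReal.ofReal_natCast, ← ENNReal.ofReal_mul (by positivity)]
      exact ENNReal.ofReal_le_ofReal ((div_le_iff₀ (by positivity)).1 hN)
  set v : ℕ → X := u ∘ τ with hv
  have hvb : MultiplierBounded v C := hu.comp_injective hτ
  have hx0 : ∀ x : C₀(ℕ, ℂ), Tendsto x cofinite (𝓝 0) := fun x => by
    have := x.zero_at_infty'
    rwa [Filter.cocompact_eq_cofinite] at this
  have hsum : ∀ x : C₀(ℕ, ℂ), Summable fun k => x k • v k := fun x =>
    hvb.summable_of_tendsto (hx0 x)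
  have hxk : ∀ (x : C₀(ℕ, ℂ)) k, ‖x k‖ ≤ ‖x‖ := fun x k => by
    rw [← ZeroAtInftyContinuousMap.norm_toBCF_eq_norm]
    exact x.toBCF.norm_coe_le_norm k
  let J₀ : C₀(ℕ, ℂ) →ₗ[ℂ] X :=
    { toFun := fun x => ∑' k, x k • v k
      map_add' := fun x y => by
        rw [← (hsum x).tsum_add (hsum y)]
        exact tsum_congr fun k => by rw [ZeroAtInftyContinuousMap.add_apply, add_smul]
      map_smul' := fun c x => by
        rw [RingHom.id_apply, ← (hsum x).tsum_const_smul c]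
        exact tsum_congr fun k => by
          rw [ZeroAtInftyContinuousMap.smul_apply, smul_eq_mul, mul_smul] }
  have hJ : ∀ x, ‖J₀ x‖ ≤ C * ‖x‖ := fun x => by
    refine le_of_tendsto (hsum x).hasSum.norm (Eventually.of_forall fun F => ?_)
    rw [mul_comm]
    exact hvb.norm_sum_le F x (norm_nonneg _) fun m _ => hxk x m
  refine ⟨J₀.mkContinuous C hJ, ⟨2 / δ, by positivity⟩, ?_⟩
  refine ContinuousLinearMap.antilipschitz_of_bound _ fun x => ?_
  change ‖x‖ ≤ 2 / δ * ‖J₀ x‖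
  have hkey : ∀ k, δ * ‖x k‖ ≤ ‖J₀ x‖ + δ / 2 * ‖x‖ := by
    intro k
    have hs : HasSum (fun l => x l * φ (τ k) (v l)) (φ (τ k) (J₀ x)) := by
      have h := (φ (τ k)).hasSum (hsum x).hasSum
      simp only [_root_.map_smul, smul_eq_mul] at h
      exact h
    have hs1 := hs.sub (hasSum_ite_eq k (x k * φ (τ k) (v k)))
    have hoff : ‖φ (τ k) (J₀ x) - x k * φ (τ k) (v k)‖ ≤ ‖x‖ * (δ / 2) := by
      refine le_of_tendsto hs1.norm (Eventually.of_forall fun F => ?_)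
      have hF : ∑ l ∈ F, (if l = k then 0 else ‖φ (τ k) (v l)‖) ≤ δ / 2 := by
        have h := (ENNReal.sum_le_tsum F).trans (hτs k)
        have he : ∀ l, (if l = k then 0 else ENNReal.ofReal ‖φ (τ k) (u (τ l))‖) =
            ENNReal.ofReal (if l = k then 0 else ‖φ (τ k) (v l)‖) := fun l => by
          split_ifs <;> simp [hv]
        simp only [he] at h
        rw [← ENNReal.ofReal_sum_of_nonneg fun l _ => by split_ifs <;> positivity] at h
        exact (ENNReal.ofReal_le_ofReal_iff (by positivity)).1 h
      refine (_root_.norm_sum_le _ _).trans (le_trans ?_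
        (mul_le_mul_of_nonneg_left hF (norm_nonneg x)))
      rw [Finset.mul_sum]
      refine Finset.sum_le_sum fun l _ => ?_
      by_cases hl : l = k
      · subst hl; simp
      · simp only [if_neg hl, sub_zero, norm_mul]
        gcongr
        exact hxk x l
    have hdiag : δ * ‖x k‖ ≤ ‖x k * φ (τ k) (v k)‖ := by
      have : ‖φ (τ k) (v k)‖ = ‖u (τ k)‖ := by
        simp only [hv, Function.comp_apply, hφ]
        simp
      rw [norm_mul, this, mul_comm]
      gcongr
      exact hδu _
    have h1 : ‖φ (τ k) (J₀ x)‖ ≤ ‖J₀ x‖ :=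
      ((φ (τ k)).le_opNorm _).trans (mul_le_of_le_one_left (norm_nonneg _) (hφ1 _))
    have h2 := norm_sub_norm_le (x k * φ (τ k) (v k)) (φ (τ k) (J₀ x))
    rw [norm_sub_rev] at h2
    linarith
  have hnorm : ‖x‖ ≤ (‖J₀ x‖ + δ / 2 * ‖x‖) / δ := by
    conv_lhs => rw [← ZeroAtInftyContinuousMap.norm_toBCF_eq_norm]
    refine (BoundedContinuousFunction.norm_le (by positivity)).2 fun k => ?_
    rw [le_div_iff₀ hδ, mul_comm]
    exact hkey k
  rw [le_div_iff₀ hδ] at hnorm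
  rw [div_mul_eq_mul_div, le_div_iff₀ hδ]
  linarith

theorem MultiplierBounded.summable_of_not_containsC0 (hX : ¬ ContainsC0 X) {u : M → X} {C : ℝ}
    (hu : MultiplierBounded u C) : Summable u := by
  classical
  by_contra hns
  rw [summable_iff_vanishing_norm] at hns
  push Not at hns
  obtain ⟨δ, hδ, h⟩ := hns
  choose t htd ht using h
  let S : ℕ → Finset M := fun n => Nat.rec ∅ (fun _ s => s ∪ t s) n
  have hS : ∀ n, S (n + 1) = S n ∪ t (S n) := fun n => rfl
  have hmono : Monotone S := monotone_nat_of_le_succ fun n => by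
    rw [hS]; exact Finset.subset_union_left
  have hdisj : Pairwise fun i j => Disjoint (t (S i)) (t (S j)) := by
    have : Std.Symm (Disjoint : Finset M → Finset M → Prop) := ⟨fun _ _ h => h.symm⟩
    refine (Std.Symm.pairwise_on (r := Disjoint) fun i => t (S i)).2 fun i j hij => ?_
    refine (Disjoint.mono_right ?_ (htd (S j))).symm
    refine le_trans ?_ (hmono (Nat.succ_le_of_lt hij))
    rw [Nat.succ_eq_add_one, hS]
    exact Finset.subset_union_right
  exact hX ((hu.blocks hdisj).containsC0 hδ fun k => ht _)

/-- The theorem of Bessaga and Pełczyński: in a space without `c₀`, weakly unconditionally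
summable families are boundedly multiplier summable. -/
theorem MultiplierBounded.summable_smul (hX : ¬ ContainsC0 X) {u : M → X} {C : ℝ}
    (hu : MultiplierBounded u C) (a : M → ℂ) (ha : ∀ m, ‖a m‖ ≤ 1) :
    Summable fun m => a m • u m := by
  refine MultiplierBounded.summable_of_not_containsC0 hX (C := C) fun F b hb => ?_
  simp only [smul_smul]
  exact hu F (fun m => b m * a m) fun m => by
    rw [norm_mul]; exact mul_le_one₀ (hb m) (norm_nonneg _) (ha m)

end Multiplier

/-! ### Gaussian random series -/

open ProbabilityTheory in
/-- Independent standard Gaussians are almost surely bounded by a multiple of any weight whose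
inverse is `8`-summable. -/
theorem ae_gaussian_le_mul {M : Type*} [Countable M] {σ : M → ℝ} (hσ : ∀ m, 0 < σ m)
    (hσs : Summable fun m => (σ m ^ 8)⁻¹) :
    ∀ᵐ ω ∂(Measure.infinitePi fun _ : M => gaussianReal 0 1),
      ∃ C : ℝ, 0 < C ∧ ∀ m, |ω m| ≤ C * σ m := by
  set P := Measure.infinitePi fun _ : M => gaussianReal 0 1 with hP
  set K := ∫⁻ x, ENNReal.ofReal (x ^ 8) ∂(gaussianReal 0 1) with hK
  have hKfin : K ≠ ⊤ := by
    have h := (memLp_id_gaussianReal (μ := 0) (v := 1) 8).integrable_norm_pow (by norm_num)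
    have h2 : Integrable (fun x : ℝ => x ^ 8) (gaussianReal 0 1) := by
      refine h.congr (Eventually.of_forall fun x => ?_)
      simp only [id, Real.norm_eq_abs]
      exact (Even.pow_abs (by decide) x)
    exact (lintegral_ofReal_ne_top_iff_integrable (by fun_prop)
      (Eventually.of_forall fun x => by positivity)).2 h2
  have hterm : ∀ m, ∫⁻ ω, ENNReal.ofReal ((ω m / σ m) ^ 8) ∂P =
      K * ENNReal.ofReal ((σ m ^ 8)⁻¹) := by
    intro m
    have h1 : ∀ x : ℝ, ENNReal.ofReal ((x / σ m) ^ 8) =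
        ENNReal.ofReal (x ^ 8) * ENNReal.ofReal ((σ m ^ 8)⁻¹) := fun x => by
      rw [← ENNReal.ofReal_mul (by positivity), div_pow, div_eq_mul_inv]
    rw [← (measurePreserving_eval_infinitePi (fun _ : M => gaussianReal 0 1) m).lintegral_comp
      (f := fun x : ℝ => ENNReal.ofReal (x ^ 8)) (by fun_prop)] at hK
    simp only [h1]
    rw [lintegral_mul_const _ (by fun_prop), hK]
  have hsum : ∫⁻ ω, ∑' m, ENNReal.ofReal ((ω m / σ m) ^ 8) ∂P ≠ ⊤ := by
    rw [lintegral_tsum fun m => Measurable.aemeasurable (by fun_prop)]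
    simp only [hterm]
    rw [ENNReal.tsum_mul_left]
    exact ENNReal.mul_ne_top hKfin hσs.tsum_ofReal_ne_top
  filter_upwards [ae_lt_top (Measurable.tsum fun m => by fun_prop) hsum] with ω hω
  set S := ∑' m, ENNReal.ofReal ((ω m / σ m) ^ 8)
  refine ⟨1 + S.toReal, by positivity, fun m => ?_⟩
  have h8 : (ω m / σ m) ^ 8 ≤ S.toReal := by
    rw [← ENNReal.ofReal_le_iff_le_toReal hω.ne]
    exact ENNReal.le_tsum (f := fun m => ENNReal.ofReal ((ω m / σ m) ^ 8)) m
  have habs : |ω m / σ m| ≤ 1 + (ω m / σ m) ^ 8 := by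
    rw [← (show Even 8 by decide).pow_abs (ω m / σ m)]
    rcases le_total |ω m / σ m| 1 with h | h
    · have : 0 ≤ |ω m / σ m| ^ 8 := by positivity
      linarith
    · have := le_self_pow₀ h (show 8 ≠ 0 by norm_num)
      linarith
  rw [abs_div, abs_of_pos (hσ m), div_le_iff₀ (hσ m)] at habs
  exact habs.trans (by have := hσ m; gcongr)

section Real

variable {M X : Type*} [NormedAddCommGroup X] [NormedSpace ℝ X]

theorem summable_sq_of_summable {c : M → ℝ} (hc : Summable c) : Summable fun m => c m ^ 2 := by
  refine Summable.of_norm_bounded_eventually hc.norm ?_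
  filter_upwards [hc.tendsto_cofinite_zero.norm.eventually_lt_const (u := 1) (by simp)] with m hm
  rw [norm_pow, sq]
  exact mul_le_of_le_one_left (norm_nonneg _) hm.le

open ProbabilityTheory in
theorem integral_exp_sum_gaussian (F : Finset M) (c : M → ℝ) :
    ∫ ω, Complex.exp (((∑ m ∈ F, ω m * c m : ℝ) : ℂ) * Complex.I)
      ∂(Measure.infinitePi fun _ : M => gaussianReal 0 1) =
      Complex.exp (((-(1 / 2) * ∑ m ∈ F, c m ^ 2 : ℝ)) : ℂ) := by
  classical
  have h1 := integral_restrict_infinitePi (μ := fun _ : M => gaussianReal 0 1) (s := F)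
    (f := fun ω : F → ℝ => Complex.exp (((∑ m : F, ω m * c m : ℝ) : ℂ) * Complex.I))
    (Measurable.aestronglyMeasurable (by fun_prop))
  have hre : ∀ ω : M → ℝ, ∑ m : F, F.restrict ω m * c m = ∑ m ∈ F, ω m * c m := fun ω => by
    rw [← Finset.sum_coe_sort F]; rfl
  simp only [hre] at h1
  rw [h1]
  have hprod : ∀ ω : F → ℝ, Complex.exp (((∑ m : F, ω m * c m : ℝ) : ℂ) * Complex.I) =
      ∏ m : F, Complex.exp ((ω m * c m : ℝ) * Complex.I) := fun ω => by
    rw [← Complex.exp_sum, Complex.ofReal_sum, Finset.sum_mul]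
  simp only [hprod]
  rw [integral_fintype_prod_eq_prod (fun (m : F) (x : ℝ) =>
    Complex.exp ((x * c m : ℝ) * Complex.I))]
  have hone : ∀ t : ℝ, ∫ x, Complex.exp ((x * t : ℝ) * Complex.I) ∂(gaussianReal 0 1) =
      Complex.exp ((-(1 / 2) * t ^ 2 : ℝ)) := fun t => by
    have h := charFun_gaussianReal (μ := 0) (v := 1) t
    rw [charFun_apply_real] at h
    convert h using 2
    · ext x; push_cast; ring_nf
    · push_cast; ring
  simp only [hone]
  rw [← Complex.exp_sum, ← Complex.ofReal_sum, ← Finset.mul_sum,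
    Finset.sum_coe_sort F fun m => c m ^ 2]

variable [MeasurableSpace X] [BorelSpace X]

open ProbabilityTheory in
theorem charFunDual_map_smul_gaussianReal (a : ℝ) (x : X) (L : StrongDual ℝ X) :
    charFunDual ((gaussianReal a 1).map fun r : ℝ => r • x) L =
      Complex.exp (a * L x * Complex.I) * Complex.exp ((-(1 / 2) * L x ^ 2 : ℝ)) := by
  rw [charFunDual_apply, integral_map (by fun_prop) (by fun_prop)]
  have h := charFun_gaussianReal (μ := a) (v := 1) (L x)
  rw [charFun_apply_real] at h
  rw [← Complex.exp_add]
  convert h using 2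
  · ext r; simp only [_root_.map_smul, smul_eq_mul]; push_cast; ring_nf
  · push_cast; ring

variable [Countable M] [SecondCountableTopology X]

open ProbabilityTheory in
/-- Existence of the Gaussian measure with covariance `∑ₘ wₘ ⊗ wₘ`, as the law of the random series
`∑ₘ γₘ wₘ` with independent standard Gaussian coefficients `γₘ`. -/
theorem exists_measure_charFunDual_eq {w : M → X} {σ : M → ℝ} (hσ : ∀ m, 1 ≤ σ m)
    (hσs : Summable fun m => (σ m ^ 8)⁻¹)
    (hw : ∀ a : M → ℝ, (∀ m, |a m| ≤ σ m) → Summable fun m => a m • w m) :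
    ∃ μ : Measure X, IsProbabilityMeasure μ ∧ ∀ L : StrongDual ℝ X,
      charFunDual μ L = Complex.exp ((-(1 / 2) * ∑' m, L (w m) ^ 2 : ℝ)) := by
  set P := Measure.infinitePi fun _ : M => gaussianReal 0 1 with hP
  have hsum : ∀ᵐ ω ∂P, Summable fun m => ω m • w m := by
    filter_upwards [ae_gaussian_le_mul (fun m => zero_lt_one.trans_le (hσ m)) hσs] with ω hω
    obtain ⟨C, hC, hω⟩ := hω
    have h := (hw (fun m => C⁻¹ * ω m) fun m => by
      rw [abs_mul, abs_of_pos (inv_pos.2 hC), inv_mul_le_iff₀ hC]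
      exact hω m).const_smul C
    simpa [smul_smul, hC.ne'] using h
  have hlim : ∀ᵐ ω ∂P, Tendsto (fun F : Finset M => ∑ m ∈ F, ω m • w m) atTop
      (𝓝 (∑' m, ω m • w m)) := hsum.mono fun ω h => h.hasSum
  have hmeas : AEMeasurable (fun ω : M → ℝ => ∑' m, ω m • w m) P :=
    aemeasurable_of_tendsto_metrizable_ae atTop
      (fun F => Measurable.aemeasurable (by fun_prop)) hlim
  refine ⟨P.map fun ω => ∑' m, ω m • w m, Measure.isProbabilityMeasure_map hmeas, fun L => ?_⟩
  rw [charFunDual_apply, integral_map hmeas (by fun_prop)]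
  have hLw : Summable fun m => L (w m) := by
    have := L.summable (hw (fun _ => 1) fun m => by simpa using hσ m)
    simpa using this
  have h1 : Tendsto (fun F : Finset M => ∫ ω, Complex.exp
      (((∑ m ∈ F, ω m * L (w m) : ℝ) : ℂ) * Complex.I) ∂P) atTop
      (𝓝 (∫ ω, Complex.exp (L (∑' m, ω m • w m) * Complex.I) ∂P)) := by
    refine tendsto_integral_filter_of_dominated_convergence (fun _ => 1)
      (Eventually.of_forall fun F => Measurable.aestronglyMeasurable (by fun_prop))
      (Eventually.of_forall fun F => Eventually.of_forall fun ω => ?_)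
      (integrable_const _) ?_
    · rw [Complex.norm_exp_ofReal_mul_I]
    · filter_upwards [hlim] with ω hω
      have h := ((L.continuous.tendsto _).comp hω)
      have h2 : Continuous fun x : ℝ => Complex.exp (x * Complex.I) := by fun_prop
      refine ((h2.tendsto _).comp h).congr fun F => ?_
      simp
  simp only [integral_exp_sum_gaussian, hP] at h1
  refine tendsto_nhds_unique h1 ?_
  have h2 : Continuous fun x : ℝ => Complex.exp ((-(1 / 2) * x : ℝ)) := by fun_prop
  exact (h2.tendsto _).comp (summable_sq_of_summable hLw).hasSum

variable [CompleteSpace X]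

open ProbabilityTheory in
/-- The Gaussian measure of a random series `∑ₘ γₘ wₘ` is quasi-invariant under translation by
multiples of the vectors `wₘ`: by uniqueness of characteristic functionals it is the convolution of
the law of `γₘ wₘ` with the law of the remaining terms, and real Gaussians are equivalent to their
translates. -/
theorem map_add_smul_absolutelyContinuous {w : M → X} {σ : M → ℝ} (hσ : ∀ m, 1 ≤ σ m)
    (hσs : Summable fun m => (σ m ^ 8)⁻¹)
    (hw : ∀ a : M → ℝ, (∀ m, |a m| ≤ σ m) → Summable fun m => a m • w m)
    {μ : Measure X} [IsProbabilityMeasure μ]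
    (hμ : ∀ L : StrongDual ℝ X,
      charFunDual μ L = Complex.exp ((-(1 / 2) * ∑' m, L (w m) ^ 2 : ℝ)))
    (m : M) (a : ℝ) : μ.map (fun x => x + a • w m) ≪ μ := by
  classical
  obtain ⟨ν, hν, hνc⟩ := exists_measure_charFunDual_eq (w := Function.update w m 0) hσ hσs
    fun b hb => by
      refine (hw (Function.update b m 0) fun k => ?_).congr fun k => ?_
      · rcases eq_or_ne k m with rfl | hk
        · simpa using zero_le_one.trans (hσ k)
        · simpa [hk] using hb k
      · rcases eq_or_ne k m with rfl | hk
        · simp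
        · simp [hk]
  have hsplit : ∀ L : StrongDual ℝ X, ∑' k, L (w k) ^ 2 =
      L (w m) ^ 2 + ∑' k, L (Function.update w m 0 k) ^ 2 := fun L => by
    have hLw : Summable fun m => L (w m) := by
      have := L.summable (hw (fun _ => 1) fun m => by simpa using hσ m)
      simpa using this
    rw [(summable_sq_of_summable hLw).tsum_eq_add_tsum_ite m]
    congr 1
    refine tsum_congr fun k => ?_
    rcases eq_or_ne k m with rfl | hk
    · simp
    · simp [hk]
  have hkey : ∀ b : ℝ, μ.map (fun x => x + b • w m) =
      ((gaussianReal b 1).map fun r : ℝ => r • w m).conv ν := fun b => by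
    have : IsProbabilityMeasure (μ.map fun x => x + b • w m) :=
      Measure.isProbabilityMeasure_map (by fun_prop)
    have : IsProbabilityMeasure ((gaussianReal b 1).map fun r : ℝ => r • w m) :=
      Measure.isProbabilityMeasure_map (by fun_prop)
    refine Measure.ext_of_charFunDual (funext fun L => ?_)
    rw [charFunDual_conv, charFunDual_map_smul_gaussianReal, hνc, charFunDual_map_add_const, hμ,
      hsplit, mul_add, Complex.ofReal_add, Complex.exp_add]
    simp only [_root_.map_smul, smul_eq_mul, Complex.ofReal_mul]
    ring
  have h0 : μ = ((gaussianReal 0 1).map fun r : ℝ => r • w m).conv ν := by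
    rw [← hkey 0]; simp
  conv_rhs => rw [h0]
  rw [hkey a]
  refine Measure.AbsolutelyContinuous.map (Measure.AbsolutelyContinuous.prod
    (Measure.AbsolutelyContinuous.map ?_ (by fun_prop)) Measure.AbsolutelyContinuous.rfl)
    (by fun_prop)
  exact (gaussianReal_absolutelyContinuous a one_ne_zero).trans
    (gaussianReal_absolutelyContinuous' 0 one_ne_zero)

/-- The Gaussian measure of a random series charges every open set as soon as the vectors of the
series have dense span: a null open set has null translates under the span, and these cover the
whole space. -/
theorem hasFullSupport_of_charFunDual_eq {w : M → X} {σ : M → ℝ} (hσ : ∀ m, 1 ≤ σ m)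
    (hσs : Summable fun m => (σ m ^ 8)⁻¹)
    (hw : ∀ a : M → ℝ, (∀ m, |a m| ≤ σ m) → Summable fun m => a m • w m)
    {μ : Measure X} [IsProbabilityMeasure μ]
    (hμ : ∀ L : StrongDual ℝ X,
      charFunDual μ L = Complex.exp ((-(1 / 2) * ∑' m, L (w m) ^ 2 : ℝ)))
    (hd : Dense (Submodule.span ℝ (Set.range w) : Set X)) : HasFullSupport μ := by
  intro U hU hne
  rw [pos_iff_ne_zero]
  intro hU0
  have hq : ∀ x ∈ Submodule.span ℝ (Set.range w), μ.map (fun y => y + x) ≪ μ := by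
    intro x hx
    induction hx using Submodule.closure_induction with
    | zero => simpa using Measure.AbsolutelyContinuous.rfl
    | add x y _ _ hx hy =>
      have h : μ.map (fun z => z + (x + y)) = (μ.map fun z => z + x).map fun z => z + y := by
        rw [Measure.map_map (by fun_prop) (by fun_prop)]
        congr 1
        ext z
        simp [add_assoc]
      rw [h]
      exact (hx.map (by fun_prop)).trans hy
    | smul_mem r x hx =>
      obtain ⟨m, rfl⟩ := hx
      exact map_add_smul_absolutelyContinuous hσ hσs hw hμ m r
  have hcov : ⋃ x : Submodule.span ℝ (Set.range w), (fun y : X => y + x) ⁻¹' U = Set.univ := by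
    refine Set.eq_univ_of_forall fun y => ?_
    obtain ⟨u, hu⟩ := hne
    obtain ⟨x, hxU, hx⟩ := hd.inter_open_nonempty ((fun x => y + x) ⁻¹' U)
      (hU.preimage (by fun_prop)) ⟨u - y, by simpa using hu⟩
    exact Set.mem_iUnion.2 ⟨⟨x, hx⟩, hxU⟩
  obtain ⟨T, hT, hTcov⟩ := TopologicalSpace.isOpen_iUnion_countable
    (fun x : Submodule.span ℝ (Set.range w) => (fun y : X => y + x) ⁻¹' U)
    fun x => hU.preimage (by fun_prop)
  have : μ Set.univ = 0 := by
    rw [← hcov, ← hTcov]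
    refine (measure_biUnion_null_iff hT).2 fun x _ => ?_
    rw [← Measure.map_apply (by fun_prop) hU.measurableSet]
    exact hq x x.2 hU0
  simp at this

end Real

/-! ### Strong mixing and characteristic functionals -/

/-- A uniformly bounded family of vectors of a Hilbert space converges weakly if it does so when
tested against a set of vectors with dense span. -/
theorem tendsto_inner_of_dense_span {ι H : Type*} [NormedAddCommGroup H] [InnerProductSpace ℂ H]
    {l : Filter ι} {S : Set H} (hS : (Submodule.span ℂ S).topologicalClosure = ⊤) {g : ι → H}
    {g₀ : H} {C : ℝ} (hg : ∀ t, ‖g t‖ ≤ C)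
    (h : ∀ x ∈ S, Tendsto (fun t => inner ℂ x (g t)) l (𝓝 (inner ℂ x g₀))) (x : H) :
    Tendsto (fun t => inner ℂ x (g t)) l (𝓝 (inner ℂ x g₀)) := by
  have hspan : ∀ x ∈ Submodule.span ℂ S,
      Tendsto (fun t => inner ℂ x (g t)) l (𝓝 (inner ℂ x g₀)) := by
    intro x hx
    induction hx using Submodule.span_induction with
    | mem x hx => exact h x hx
    | zero => simpa using tendsto_const_nhds
    | add x y _ _ hx hy => simpa only [inner_add_left] using hx.add hy
    | smul c x _ hx => simpa only [inner_smul_left] using hx.const_mul _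
  have hx : x ∈ closure (Submodule.span ℂ S : Set H) := by
    rw [← Submodule.topologicalClosure_coe, hS]; trivial
  rw [Metric.tendsto_nhds]
  intro ε hε
  have hD : 0 < |C| + ‖g₀‖ + 1 := by positivity
  obtain ⟨y, hy, hxy⟩ := Metric.mem_closure_iff.1 hx (ε / 2 / (|C| + ‖g₀‖ + 1)) (by positivity)
  filter_upwards [Metric.tendsto_nhds.1 (hspan y hy) (ε / 2) (by positivity)] with t ht
  rw [dist_eq_norm] at hxy ht ⊢
  have h1 : inner ℂ x (g t) - inner ℂ x g₀ =
      inner ℂ (x - y) (g t) - inner ℂ (x - y) g₀ + (inner ℂ y (g t) - inner ℂ y g₀) := by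
    simp only [inner_sub_left]; ring
  have h2 : ‖inner ℂ (x - y) (g t)‖ ≤ ‖x - y‖ * |C| :=
    (norm_inner_le_norm _ _).trans (by gcongr; exact (hg t).trans (le_abs_self C))
  have h3 : ‖inner ℂ (x - y) g₀‖ ≤ ‖x - y‖ * ‖g₀‖ := norm_inner_le_norm _ _
  rw [lt_div_iff₀ hD] at hxy
  rw [h1]
  calc _ ≤ ‖inner ℂ (x - y) (g t)‖ + ‖inner ℂ (x - y) g₀‖ + ‖inner ℂ y (g t) - inner ℂ y g₀‖ :=
        (norm_add_le _ _).trans (by gcongr; exact norm_sub_le _ _)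
    _ < ε := by nlinarith [norm_nonneg (x - y)]

section CharacterDensity

theorem conj_exp_dual {X : Type*} [NormedAddCommGroup X] [NormedSpace ℝ X]
    (L : StrongDual ℝ X) (x : X) :
    (starRingEnd ℂ) (Complex.exp (L x * Complex.I)) = Complex.exp ((-L) x * Complex.I) := by
  rw [← Complex.exp_conj]
  simp

variable {X : Type*} [NormedAddCommGroup X] [NormedSpace ℝ X] [MeasurableSpace X] [BorelSpace X]

theorem measurable_exp_dual (L : StrongDual ℝ X) :
    Measurable fun x => Complex.exp (L x * Complex.I) := by fun_prop

theorem memLp_exp_dual (μ : Measure X) [IsFiniteMeasure μ] (L : StrongDual ℝ X) :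
    MemLp (fun x => Complex.exp (L x * Complex.I)) 2 μ :=
  MemLp.of_bound (measurable_exp_dual L).aestronglyMeasurable 1
    (Eventually.of_forall fun x => by rw [Complex.norm_exp_ofReal_mul_I])

/-- The character `x ↦ exp (i L x)` as an element of `L²(μ)`. -/
noncomputable def charLp (μ : Measure X) [IsFiniteMeasure μ] (L : StrongDual ℝ X) : Lp ℂ 2 μ :=
  (memLp_exp_dual μ L).toLp

variable [CompleteSpace X] [SecondCountableTopology X] {μ : Measure X}

theorem ae_eq_zero_of_forall_integral_exp_mul_ofReal_eq_zero {g : X → ℝ} (hg : Integrable g μ)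
    (h : ∀ L : StrongDual ℝ X, ∫ x, Complex.exp (L x * Complex.I) * g x ∂μ = 0) :
    g =ᵐ[μ] 0 := by
  have hgn : Integrable (fun x => -g x) μ := hg.neg
  have hfin : ∀ {u : X → ℝ}, Integrable u μ → ∫⁻ x, ENNReal.ofReal (u x) ∂μ ≠ ⊤ := fun hu =>
    hu.lintegral_lt_top.ne
  have : IsFiniteMeasure (μ.withDensity fun x => ENNReal.ofReal (g x)) :=
    isFiniteMeasure_withDensity (hfin hg)
  have : IsFiniteMeasure (μ.withDensity fun x => ENNReal.ofReal (-g x)) :=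
    isFiniteMeasure_withDensity (hfin hgn)
  have hpos : ∀ {u : X → ℝ} (L : StrongDual ℝ X), Integrable u μ →
      Integrable (fun x => ((u x ⊔ 0 : ℝ) : ℂ) * Complex.exp (L x * Complex.I)) μ := fun {u} L hu =>
    (hu.pos_part.ofReal (𝕜 := ℂ)).mul_bdd (c := 1) (measurable_exp_dual L).aestronglyMeasurable
      (Eventually.of_forall fun x => by rw [Complex.norm_exp_ofReal_mul_I])
  have heq : (μ.withDensity fun x => ENNReal.ofReal (g x)) =
      μ.withDensity fun x => ENNReal.ofReal (-g x) := by
    refine Measure.ext_of_charFunDual (funext fun L => ?_)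
    have hL := h L
    rw [charFunDual_apply, charFunDual_apply,
      integral_withDensity_eq_integral_toReal_smul₀ hg.1.aemeasurable.ennreal_ofReal
        (Eventually.of_forall fun _ => ENNReal.ofReal_lt_top),
      integral_withDensity_eq_integral_toReal_smul₀ hgn.1.aemeasurable.ennreal_ofReal
        (Eventually.of_forall fun _ => ENNReal.ofReal_lt_top), ← sub_eq_zero]
    simp only [ENNReal.toReal_ofReal', Complex.real_smul]
    rw [← integral_sub (hpos L hg) (hpos L hgn), ← hL]
    refine integral_congr_ae (Eventually.of_forall fun x => ?_)
    have h1 : (g x ⊔ 0) - (-g x ⊔ 0) = g x := by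
      rcases le_total 0 (g x) with h0 | h0
      · rw [max_eq_left h0, max_eq_right (by linarith), sub_zero]
      · rw [max_eq_right h0, max_eq_left (by linarith)]; ring
    have h2 := congrArg (fun r : ℝ => (r : ℂ)) h1
    push_cast at h2
    linear_combination Complex.exp (L x * Complex.I) * h2
  rw [withDensity_eq_iff hg.1.aemeasurable.ennreal_ofReal hgn.1.aemeasurable.ennreal_ofReal
    (hfin hg)] at heq
  filter_upwards [heq] with x hx
  rcases lt_trichotomy (g x) 0 with h0 | h0 | h0
  · have := ENNReal.ofReal_pos.2 (neg_pos.2 h0)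
    rw [← hx, ENNReal.ofReal_pos] at this
    exact absurd this h0.not_gt
  · exact h0
  · have := ENNReal.ofReal_pos.2 h0
    rw [hx, ENNReal.ofReal_pos] at this
    linarith

/-- Trigonometric polynomials are dense in `L²(μ)`: a function orthogonal to all characters is the
density of a complex measure with vanishing characteristic functional. -/
theorem topologicalClosure_span_charLp (μ : Measure X) [IsFiniteMeasure μ] :
    (Submodule.span ℂ (Set.range (charLp μ))).topologicalClosure = ⊤ := by
  rw [Submodule.topologicalClosure_eq_top_iff, Submodule.eq_bot_iff]
  intro u hu
  have hui : Integrable u μ := (Lp.memLp u).integrable (by norm_num)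
  have h0 : ∀ L : StrongDual ℝ X, ∫ x, Complex.exp (L x * Complex.I) * u x ∂μ = 0 := by
    intro L
    have h := (Submodule.mem_orthogonal _ _).1 hu (charLp μ (-L)) (Submodule.subset_span ⟨-L, rfl⟩)
    rw [L2.inner_def] at h
    rw [← h]
    refine integral_congr_ae ?_
    filter_upwards [(memLp_exp_dual μ (-L)).coeFn_toLp] with x hx
    rw [charLp, hx, RCLike.inner_apply, conj_exp_dual, neg_neg, mul_comm]
  have hi : ∀ {v : X → ℂ} (L : StrongDual ℝ X), Integrable v μ →
      Integrable (fun x => Complex.exp (L x * Complex.I) * v x) μ := fun L hv =>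
    hv.bdd_mul (c := 1) (measurable_exp_dual L).aestronglyMeasurable
      (Eventually.of_forall fun x => by rw [Complex.norm_exp_ofReal_mul_I])
  have hui' : Integrable (fun x => (starRingEnd ℂ) (u x)) μ :=
    (Complex.conjCLE.toContinuousLinearMap).integrable_comp hui
  have h0' : ∀ L : StrongDual ℝ X,
      ∫ x, Complex.exp (L x * Complex.I) * (starRingEnd ℂ) (u x) ∂μ = 0 := by
    intro L
    have h := congrArg (starRingEnd ℂ) (h0 (-L))
    rw [← integral_conj, map_zero] at h
    rw [← h]
    refine integral_congr_ae (Eventually.of_forall fun x => ?_)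
    simp only [map_mul, conj_exp_dual, neg_neg]
  have hre : (fun x => (u x).re) =ᵐ[μ] 0 := by
    refine ae_eq_zero_of_forall_integral_exp_mul_ofReal_eq_zero hui.re fun L => ?_
    have h : ∫ x, (1 / 2 : ℂ) * (Complex.exp (L x * Complex.I) * u x +
        Complex.exp (L x * Complex.I) * (starRingEnd ℂ) (u x)) ∂μ = 0 := by
      rw [integral_const_mul, integral_add (hi L hui) (hi L hui'), h0, h0']; simp
    rw [← h]
    refine integral_congr_ae (Eventually.of_forall fun x => ?_)
    simp only [Complex.re_eq_add_conj]
    ring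
  have him : (fun x => (u x).im) =ᵐ[μ] 0 := by
    refine ae_eq_zero_of_forall_integral_exp_mul_ofReal_eq_zero hui.im fun L => ?_
    have h : ∫ x, (1 / (2 * Complex.I) : ℂ) * (Complex.exp (L x * Complex.I) * u x -
        Complex.exp (L x * Complex.I) * (starRingEnd ℂ) (u x)) ∂μ = 0 := by
      rw [integral_const_mul, integral_sub (hi L hui) (hi L hui'), h0, h0']; simp
    rw [← h]
    refine integral_congr_ae (Eventually.of_forall fun x => ?_)
    simp only [Complex.im_eq_sub_conj]
    ring
  refine Lp.ext ?_
  filter_upwards [hre, him, Lp.coeFn_zero ℂ 2 μ] with x h1 h2 h3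
  rw [h3]
  exact Complex.ext h1 h2

end CharacterDensity

section Mixing

variable {X : Type*} [NormedAddCommGroup X] [NormedSpace ℂ X] [CompleteSpace X]
  [SecondCountableTopology X] [MeasurableSpace X] [BorelSpace X]

/-- Strong mixing can be read off from the joint characteristic functional of `x` and `T t x`. -/
theorem isStronglyMixing_of_tendsto_charFunDual {T : ℝ≥0 → X →L[ℂ] X} {μ : Measure X}
    [IsProbabilityMeasure μ] (hinv : IsInvariant T μ)
    (h : ∀ L L' : StrongDual ℝ X,
      Tendsto (fun t => charFunDual μ (L + L'.comp ((T t).restrictScalars ℝ))) atTop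
        (𝓝 (charFunDual μ L * charFunDual μ L'))) :
    IsStronglyMixing T μ := by
  let U : ℝ≥0 → Lp ℂ 2 μ →ₗᵢ[ℂ] Lp ℂ 2 μ := fun t =>
    Lp.compMeasurePreservingₗᵢ ℂ (T t) (hinv t)
  let e : Lp ℂ 2 μ := indicatorConstLp 2 MeasurableSet.univ (measure_ne_top μ _) (1 : ℂ)
  have he : ∀ L, inner ℂ e (charLp μ L) = charFunDual μ L := fun L => by
    rw [L2.inner_indicatorConstLp_one, setIntegral_univ, charFunDual_apply]
    exact integral_congr_ae (memLp_exp_dual μ L).coeFn_toLp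
  have hU : ∀ t L L', inner ℂ (charLp μ L) (U t (charLp μ L')) =
      charFunDual μ (-L + L'.comp ((T t).restrictScalars ℝ)) := fun t L L' => by
    rw [L2.inner_def, charFunDual_apply]
    refine integral_congr_ae ?_
    filter_upwards [(memLp_exp_dual μ L).coeFn_toLp,
      Lp.coeFn_compMeasurePreserving (charLp μ L') (hinv t),
      (hinv t).quasiMeasurePreserving.ae (memLp_exp_dual μ L').coeFn_toLp] with x h1 h2 h3
    have h2' : (U t (charLp μ L')) x = charLp μ L' (T t x) := h2
    rw [h2', charLp, charLp, h1, h3, RCLike.inner_apply, conj_exp_dual, ← Complex.exp_add]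
    congr 1
    simp
    ring
  have hconj : ∀ L, inner ℂ (charLp μ L) e = charFunDual μ (-L) := fun L => by
    rw [← inner_conj_symm, he, charFunDual_apply, charFunDual_apply, ← integral_conj]
    exact integral_congr_ae (Eventually.of_forall fun x => conj_exp_dual L x)
  have step1 : ∀ (L' : StrongDual ℝ X) (F : Lp ℂ 2 μ),
      Tendsto (fun t => inner ℂ F (U t (charLp μ L'))) atTop
        (𝓝 (inner ℂ F (inner ℂ e (charLp μ L') • e))) := by
    intro L' F
    refine tendsto_inner_of_dense_span (topologicalClosure_span_charLp μ)
      (fun t => ((U t).norm_map _).le) ?_ F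
    rintro _ ⟨L, rfl⟩
    simp only [hU, inner_smul_right, he, hconj]
    rw [mul_comm]
    exact h (-L) L'
  have step2 : ∀ F G : Lp ℂ 2 μ, Tendsto (fun t => inner ℂ F (U t G)) atTop
      (𝓝 (inner ℂ F (inner ℂ e G • e))) := by
    intro F G
    have h2 := tendsto_inner_of_dense_span (l := atTop) (topologicalClosure_span_charLp μ)
      (g := fun t => ContinuousLinearMap.adjoint (U t).toContinuousLinearMap F)
      (g₀ := inner ℂ e F • e) (C := ‖F‖) (fun t => by
        refine (ContinuousLinearMap.le_opNorm _ _).trans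
          (mul_le_of_le_one_left (norm_nonneg _) ?_)
        rw [LinearIsometryEquiv.norm_map]
        exact LinearIsometry.norm_toContinuousLinearMap_le _) (by
        rintro _ ⟨L', rfl⟩
        have h3 := (Complex.continuous_conj.tendsto _).comp (step1 L' F)
        simp only [Function.comp_def, inner_conj_symm] at h3
        refine (h3.congr fun t => ?_).trans (le_of_eq ?_)
        · rw [ContinuousLinearMap.adjoint_inner_right]; rfl
        · simp only [inner_smul_left, inner_smul_right, inner_conj_symm]
          rw [mul_comm]) G
    have h3 := (Complex.continuous_conj.tendsto _).comp h2
    simp only [Function.comp_def, inner_conj_symm] at h3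
    refine (h3.congr fun t => ?_).trans (le_of_eq ?_)
    · rw [ContinuousLinearMap.adjoint_inner_left]; rfl
    · simp only [inner_smul_left, inner_smul_right, inner_conj_symm]
      rw [mul_comm]
  intro A B hA hB
  have h4 := step2 (indicatorConstLp 2 hA (measure_ne_top μ _) 1)
    (indicatorConstLp 2 hB (measure_ne_top μ _) 1)
  have hUB : ∀ t, U t (indicatorConstLp 2 hB (measure_ne_top μ _) 1) =
      indicatorConstLp 2 (hB.preimage (hinv t).measurable) (measure_ne_top μ _) 1 := fun t =>
    Lp.indicatorConstLp_compMeasurePreserving hB (measure_ne_top μ _) 1 (hinv t)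
  have hin : ∀ {C D : Set X} (hC : MeasurableSet C) (hD : MeasurableSet D),
      inner ℂ (indicatorConstLp 2 hC (measure_ne_top μ C) (1 : ℂ))
        (indicatorConstLp 2 hD (measure_ne_top μ D) (1 : ℂ)) = (μ.real (C ∩ D) : ℂ) := by
    intro C D hC hD
    rw [L2.inner_indicatorConstLp_one, setIntegral_congr_ae hC
      (indicatorConstLp_coeFn.mono fun x hx _ => hx), setIntegral_indicator hD]
    simp
  simp only [hUB, inner_smul_right, e, hin, Set.univ_inter, Set.inter_univ] at h4
  have h5 := (Complex.continuous_re.tendsto _).comp h4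
  simp only [Function.comp_def, Complex.ofReal_re, ← Complex.ofReal_mul] at h5
  have h6 := ENNReal.tendsto_ofReal h5
  rw [ENNReal.ofReal_mul (by positivity), mul_comm] at h6
  simpa [Measure.real] using h6

end Mixing

/-! ### Eigenvectors, oscillation and Fourier coefficients -/

theorem dense_span_of_forall_dual_eq_zero {𝕜 X : Type*} [RCLike 𝕜] [NormedAddCommGroup X]
    [NormedSpace 𝕜 X] {S : Set X}
    (h : ∀ φ : StrongDual 𝕜 X, (∀ x ∈ S, φ x = 0) → φ = 0) :
    Dense (Submodule.span 𝕜 S : Set X) := by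
  rw [Submodule.dense_iff_topologicalClosure_eq_top]
  set K := (Submodule.span 𝕜 S).topologicalClosure with hK
  have hKc : IsClosed (K : Set X) := Submodule.isClosed_topologicalClosure _
  by_contra hne
  obtain ⟨x, -, hx⟩ := SetLike.exists_of_lt (lt_top_iff_ne_top.2 hne)
  have hx' : (K.mkQ x : X ⧸ K) ≠ 0 := by simpa [Submodule.Quotient.mk_eq_zero] using hx
  obtain ⟨ψ, hψ⟩ := SeparatingDual.exists_ne_zero (R := 𝕜) hx'
  have h0 := h (ψ.comp K.mkQL) fun y hy => by
    have : K.mkQ y = 0 := by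
      simpa [Submodule.Quotient.mk_eq_zero] using
        (Submodule.span 𝕜 S).le_topologicalClosure (Submodule.subset_span hy)
    change ψ (K.mkQ y) = 0
    rw [this, map_zero]
  exact hψ (congrArg (fun φ : StrongDual 𝕜 X => φ x) h0)

section Eigenvector

variable {X : Type*} [NormedAddCommGroup X] [NormedSpace ℂ X]

/-- An eigenvector of the generator is an eigenvector of the whole semigroup: the function
`s ↦ exp (-c s) T s x` is continuous with vanishing right derivative. -/
theorem IsC0Semigroup.apply_eq_exp_smul {T : ℝ≥0 → X →L[ℂ] X} (hT : IsC0Semigroup T) {x : X}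
    {c : ℂ} (h : HasGeneratorValue T x (c • x)) (t : ℝ≥0) :
    T t x = Complex.exp (c * (t : ℝ)) • x := by
  have hcont : Continuous fun s : ℝ≥0 => T s x := continuous_iff_continuousAt.2 (hT.tendsto x)
  have hcont' : Continuous fun s : ℝ => T s.toNNReal x := hcont.comp continuous_real_toNNReal
  have hderiv : ∀ s : ℝ, 0 ≤ s →
      HasDerivWithinAt (fun s : ℝ => T s.toNNReal x) (c • T s.toNNReal x) (Set.Ici s) s := by
    intro s hs
    rw [← hasDerivWithinAt_Ioi_iff_Ici, hasDerivWithinAt_iff_tendsto_slope' Set.self_notMem_Ioi]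
    have h1 : Tendsto (fun r : ℝ => (r - s).toNNReal) (𝓝[>] s) (𝓝[>] 0) := by
      refine tendsto_nhdsWithin_iff.2 ⟨?_, ?_⟩
      · have : Continuous fun r : ℝ => (r - s).toNNReal := by fun_prop
        have h2 := this.tendsto s
        simp only [sub_self, Real.toNNReal_zero] at h2
        exact h2.mono_left nhdsWithin_le_nhds
      · filter_upwards [self_mem_nhdsWithin] with r hr
        exact Real.toNNReal_pos.2 (sub_pos.2 hr)
    have h2 := ((T s.toNNReal).continuous.tendsto _).comp (h.comp h1)
    rw [_root_.map_smul] at h2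
    refine h2.congr' ?_
    filter_upwards [self_mem_nhdsWithin] with r hr
    have hrs : 0 < r - s := sub_pos.2 hr
    have hadd : r.toNNReal = s.toNNReal + (r - s).toNNReal := by
      rw [← Real.toNNReal_add hs hrs.le]; congr 1; ring
    simp only [Function.comp_apply, slope_def_module, _root_.map_smul, map_sub]
    rw [hadd, hT.map_add, Real.coe_toNNReal _ hrs.le, ContinuousLinearMap.comp_apply,
      ← Complex.ofReal_inv, Complex.coe_smul]
  have hexp : ∀ s : ℝ, HasDerivAt (fun s : ℝ => Complex.exp (-c * s))
      (Complex.exp (-c * s) * -c) s := fun s => by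
    have h1 : HasDerivAt (fun s : ℝ => -c * (s : ℂ)) (-c) s := by
      simpa using (Complex.ofRealCLM.hasDerivAt (x := s)).const_mul (-c)
    exact h1.cexp
  have hconst := constant_of_has_deriv_right_zero (a := 0) (b := (t : ℝ))
    (f := fun s : ℝ => Complex.exp (-c * s) • T s.toNNReal x)
    ((Complex.continuous_exp.comp (continuous_const.mul Complex.continuous_ofReal)).smul
      hcont').continuousOn (fun s hs => by
      refine ((hexp s).hasDerivWithinAt.smul (hderiv s hs.1)).congr_deriv ?_
      rw [smul_smul, ← add_smul]
      convert zero_smul ℂ _ using 2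
      ring) t (Set.right_mem_Icc.2 t.2)
  simp only [Real.toNNReal_coe, Complex.ofReal_zero, mul_zero, Complex.exp_zero,
    Real.toNNReal_zero, hT.map_zero, one_smul, ContinuousLinearMap.id_apply] at hconst
  conv_rhs => rw [← hconst]
  rw [smul_smul, ← Complex.exp_add]
  simp

theorem hasGeneratorValue_of_generator_eq {T : ℝ≥0 → X →L[ℂ] X} {x y : X}
    (h : x ∈ (generator T).domain) (hxy : generator T ⟨x, h⟩ = y) : HasGeneratorValue T x y := by
  rw [← hxy]
  exact Classical.choose_spec h

end Eigenvector

section Oscillation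

open scoped FourierTransform in
theorem tendsto_integral_exp_mul (g : ℝ → ℂ) :
    Tendsto (fun t : ℝ≥0 => ∫ s : ℝ, Complex.exp (Complex.I * s * (t : ℝ)) * g s) atTop
      (𝓝 0) := by
  have h := (Real.tendsto_integral_exp_smul_cocompact g).comp
    (show Tendsto (fun t : ℝ≥0 => -((t : ℝ) / (2 * Real.pi))) atTop (cocompact ℝ) from
      (tendsto_neg_atTop_atBot.comp ((NNReal.tendsto_coe_atTop.2 tendsto_id).atTop_div_const
        (by positivity))).mono_right atBot_le_cocompact)
  refine h.congr fun t => integral_congr_ae (Eventually.of_forall fun s => ?_)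
  simp only [Circle.smul_def, smul_eq_mul, Real.fourierChar_apply]
  congr 2
  push_cast
  field_simp

/-- Oscillating factors make two functions asymptotically orthogonal in `L²`, by the
Riemann–Lebesgue lemma. -/
theorem tendsto_integral_norm_add_exp_mul_sq {p q : ℝ} (hpq : p ≤ q) {g₁ g₂ : ℝ → ℂ}
    (h₁ : ContinuousOn g₁ (Set.Icc p q)) (h₂ : ContinuousOn g₂ (Set.Icc p q)) :
    Tendsto (fun t : ℝ≥0 => ∫ s in p..q, ‖g₁ s + Complex.exp (Complex.I * s * (t : ℝ)) * g₂ s‖ ^ 2)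
      atTop (𝓝 ((∫ s in p..q, ‖g₁ s‖ ^ 2) + ∫ s in p..q, ‖g₂ s‖ ^ 2)) := by
  have hexp : ∀ (t : ℝ≥0) (s : ℝ), ‖Complex.exp (Complex.I * s * (t : ℝ))‖ = 1 := fun t s => by
    rw [show Complex.I * s * (t : ℝ) = ((s * t : ℝ) : ℂ) * Complex.I by push_cast; ring,
      Complex.norm_exp_ofReal_mul_I]
  have hRL := tendsto_integral_exp_mul
    ((Set.Ioc p q).indicator fun s => g₂ s * (starRingEnd ℂ) (g₁ s))
  have hRL2 := ((Complex.continuous_re.tendsto _).comp hRL).const_mul 2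
  simp only [Complex.zero_re, mul_zero] at hRL2
  have hlim := hRL2.const_add ((∫ s in p..q, ‖g₁ s‖ ^ 2) + ∫ s in p..q, ‖g₂ s‖ ^ 2)
  rw [add_zero] at hlim
  refine hlim.congr fun t => ?_
  have hind : ∫ s : ℝ, Complex.exp (Complex.I * s * (t : ℝ)) *
      (Set.Ioc p q).indicator (fun s => g₂ s * (starRingEnd ℂ) (g₁ s)) s =
      ∫ s in p..q, Complex.exp (Complex.I * s * (t : ℝ)) * (g₂ s * (starRingEnd ℂ) (g₁ s)) := by
    rw [intervalIntegral.integral_of_le hpq, ← integral_indicator measurableSet_Ioc]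
    refine integral_congr_ae (Eventually.of_forall fun s => ?_)
    by_cases hs : s ∈ Set.Ioc p q <;> simp [hs]
  have hc : ContinuousOn (fun s : ℝ => Complex.exp (Complex.I * s * (t : ℝ)) *
      (g₂ s * (starRingEnd ℂ) (g₁ s))) (Set.uIcc p q) := by
    rw [Set.uIcc_of_le hpq]
    have he : Continuous fun s : ℝ => Complex.exp (Complex.I * s * (t : ℝ)) :=
      Complex.continuous_exp.comp
        ((continuous_const.mul Complex.continuous_ofReal).mul continuous_const)
    exact he.continuousOn.mul (h₂.mul (Complex.continuous_conj.comp_continuousOn h₁))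
  rw [← Set.uIcc_of_le hpq] at h₁ h₂
  have hre : (∫ s in p..q, Complex.exp (Complex.I * s * (t : ℝ)) *
      (g₂ s * (starRingEnd ℂ) (g₁ s))).re =
      ∫ s in p..q, (Complex.exp (Complex.I * s * (t : ℝ)) * (g₂ s * (starRingEnd ℂ) (g₁ s))).re :=
    (Complex.reCLM.intervalIntegral_comp_comm hc.intervalIntegrable).symm
  simp only [Function.comp_apply, hind]
  have hi₁ : IntervalIntegrable (fun s => ‖g₁ s‖ ^ 2) volume p q :=
    (h₁.norm.pow 2).intervalIntegrable
  have hi₂ : IntervalIntegrable (fun s => ‖g₂ s‖ ^ 2) volume p q :=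
    (h₂.norm.pow 2).intervalIntegrable
  rw [hre, ← intervalIntegral.integral_add hi₁ hi₂, ← intervalIntegral.integral_const_mul,
    ← intervalIntegral.integral_add]
  · refine intervalIntegral.integral_congr fun s _ => ?_
    rw [add_comm (g₁ s), ← Complex.normSq_eq_norm_sq (_ + _), Complex.normSq_add,
      Complex.normSq_eq_norm_sq, Complex.normSq_eq_norm_sq, norm_mul, hexp, one_mul, ← mul_assoc]
    ring
  · exact hi₁.add hi₂
  · exact (Complex.continuous_re.comp_continuousOn hc).intervalIntegrable.const_mul 2

end Oscillation

section FourierDecay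

open Set

theorem norm_fourierCoeffOn_le {X : Type*} [NormedAddCommGroup X] [NormedSpace ℂ X] {p q : ℝ}
    (hpq : p < q) {g : ℝ → X} {C : ℝ} (hC : ∀ s ∈ Icc p q, ‖g s‖ ≤ C) (n : ℤ) :
    ‖fourierCoeffOn hpq g n‖ ≤ C := by
  have hqp : 0 < q - p := sub_pos.2 hpq
  rw [fourierCoeffOn_eq_integral, norm_smul, Real.norm_of_nonneg (by positivity)]
  have h := intervalIntegral.norm_integral_le_of_norm_le_const (a := p) (b := q) (C := C)
    (f := fun x : ℝ => fourier (-n) (x : AddCircle (q - p)) • g x) fun s hs => by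
      rw [uIoc_of_le hpq.le] at hs
      rw [norm_smul, fourier_apply, Circle.norm_coe, one_mul]
      exact hC s (Ioc_subset_Icc_self hs)
  rw [abs_of_pos hqp] at h
  rw [one_div, inv_mul_le_iff₀ hqp, mul_comm]
  exact h

theorem norm_fourierCoeffOn_eq_of_hasDerivAt {p q : ℝ} (hpq : p < q) {g g' : ℝ → ℂ}
    (hg : ∀ s ∈ Icc p q, HasDerivAt g (g' s) s) (hg' : ContinuousOn g' (Icc p q))
    (hb : g p = g q) {n : ℤ} (hn : n ≠ 0) :
    ‖fourierCoeffOn hpq g n‖ =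
      (q - p) / (2 * Real.pi) * (‖fourierCoeffOn hpq g' n‖ / |(n : ℝ)|) := by
  have hqp : 0 < q - p := sub_pos.2 hpq
  rw [← uIcc_of_le hpq.le] at hg hg'
  rw [fourierCoeffOn_of_hasDerivAt hpq hn hg hg'.intervalIntegrable, hb, sub_self, mul_zero,
    zero_sub, norm_mul, norm_neg, norm_mul, ← Complex.ofReal_sub, Complex.norm_real,
    Real.norm_of_nonneg hqp.le]
  simp only [norm_div, norm_mul, norm_neg, Complex.norm_I, norm_one, Complex.norm_real,
    Complex.norm_intCast, Real.norm_eq_abs, abs_of_pos Real.pi_pos, Complex.norm_ofNat]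
  field_simp

theorem memLp_two_Ioc_of_continuousOn {p q : ℝ} {g : ℝ → ℂ} (hg : ContinuousOn g (Icc p q)) :
    MemLp g 2 (volume.restrict (Ioc p q)) := by
  obtain ⟨C, hC⟩ := isCompact_Icc.exists_bound_of_continuousOn hg
  exact MemLp.of_bound ((hg.mono Ioc_subset_Icc_self).aestronglyMeasurable measurableSet_Ioc) C
    ((ae_restrict_iff' measurableSet_Ioc).2
      (Eventually.of_forall fun s hs => hC s (Ioc_subset_Icc_self hs)))

/-- The weight `(1 + |n|) ^ (1/4)` is dominated by the decay of Fourier coefficients but its inverse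
is `8`-summable. -/
noncomputable def fourierWeight (n : ℤ) : ℝ := (1 + |(n : ℝ)|) ^ (1 / 4 : ℝ)

theorem one_le_fourierWeight (n : ℤ) : 1 ≤ fourierWeight n :=
  Real.one_le_rpow (by have := abs_nonneg (n : ℝ); linarith) (by norm_num)

theorem fourierWeight_pow_eight (n : ℤ) : fourierWeight n ^ 8 = (1 + |(n : ℝ)|) ^ 2 := by
  rw [fourierWeight, ← Real.rpow_natCast, ← Real.rpow_mul (by positivity), ← Real.rpow_natCast]
  norm_num

theorem summable_inv_fourierWeight_pow_eight : Summable fun n : ℤ => (fourierWeight n ^ 8)⁻¹ := by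
  have h := (Real.summable_one_div_int_pow (p := 2)).2 (by norm_num)
  refine h.of_norm_bounded_eventually ?_
  filter_upwards [(Set.finite_singleton (0 : ℤ)).compl_mem_cofinite] with n hn
  have hn' : (n : ℝ) ≠ 0 := by simpa using hn
  have : 0 < |(n : ℝ)| := abs_pos.2 hn'
  rw [fourierWeight_pow_eight, Real.norm_of_nonneg (by positivity), one_div, ← sq_abs (n : ℝ)]
  gcongr
  linarith

theorem summable_fourierWeight_sq_div :
    Summable fun n : ℤ => (fourierWeight n / |(n : ℝ)|) ^ 2 := by
  have h := (Real.summable_abs_int_rpow (b := 3 / 2) (by norm_num)).mul_left (2 : ℝ)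
  refine h.of_norm_bounded_eventually ?_
  filter_upwards [(Set.finite_singleton (0 : ℤ)).compl_mem_cofinite] with n hn
  have hn' : n ≠ 0 := by simpa using hn
  have h1 : (1 : ℝ) ≤ |(n : ℝ)| := by exact_mod_cast Int.one_le_abs hn'
  have h0 : 0 < |(n : ℝ)| := by linarith
  rw [Real.norm_of_nonneg (by positivity), div_pow]
  have hw : fourierWeight n ^ 2 ≤ 2 * |(n : ℝ)| ^ (1 / 2 : ℝ) := by
    rw [fourierWeight, ← Real.rpow_natCast, ← Real.rpow_mul (by positivity)]
    calc ((1 + |(n : ℝ)|) ^ (1 / 4 * ((2 : ℕ) : ℝ)) : ℝ) ≤ (2 * |(n : ℝ)|) ^ (1 / 2 : ℝ) := by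
          norm_num
          gcongr
          linarith
      _ = 2 ^ (1 / 2 : ℝ) * |(n : ℝ)| ^ (1 / 2 : ℝ) := Real.mul_rpow (by norm_num) h0.le
      _ ≤ 2 * |(n : ℝ)| ^ (1 / 2 : ℝ) := by
          gcongr
          exact Real.rpow_le_self_of_one_le (by norm_num) (by norm_num)
  rw [div_le_iff₀ (by positivity)]
  refine hw.trans (le_of_eq ?_)
  rw [mul_assoc, ← Real.rpow_natCast |(n : ℝ)| 2, ← Real.rpow_add h0]
  norm_num

/-- A `C¹` function with matching boundary values has Fourier coefficients that are summable
against `fourierWeight`: the coefficients of its derivative are square summable. -/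
theorem summable_fourierWeight_mul_norm_fourierCoeffOn {p q : ℝ} (hpq : p < q) {g g' : ℝ → ℂ}
    (hg : ∀ s ∈ Icc p q, HasDerivAt g (g' s) s) (hg' : ContinuousOn g' (Icc p q))
    (hb : g p = g q) : Summable fun n => fourierWeight n * ‖fourierCoeffOn hpq g n‖ := by
  have hqp : 0 < q - p := sub_pos.2 hpq
  have hsq := (hasSum_sq_fourierCoeffOn hpq (memLp_two_Ioc_of_continuousOn hg')).summable
  refine ((summable_fourierWeight_sq_div.add hsq).mul_left
    ((q - p) / (2 * Real.pi))).of_norm_bounded_eventually ?_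
  filter_upwards [(Set.finite_singleton (0 : ℤ)).compl_mem_cofinite] with n hn
  have hn' : n ≠ 0 := by simpa using hn
  have hw := (zero_lt_one.trans_le (one_le_fourierWeight n)).le
  rw [Real.norm_of_nonneg (by positivity), norm_fourierCoeffOn_eq_of_hasDerivAt hpq hg hg' hb hn']
  have h := two_mul_le_add_sq (fourierWeight n / |(n : ℝ)|) ‖fourierCoeffOn hpq g' n‖
  have h2 : fourierWeight n * ((q - p) / (2 * Real.pi) *
      (‖fourierCoeffOn hpq g' n‖ / |(n : ℝ)|)) = (q - p) / (2 * Real.pi) *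
      ((fourierWeight n / |(n : ℝ)|) * ‖fourierCoeffOn hpq g' n‖) := by ring
  rw [h2]
  have : 0 ≤ fourierWeight n / |(n : ℝ)| * ‖fourierCoeffOn hpq g' n‖ := by positivity
  gcongr
  linarith

variable {X : Type*} [NormedAddCommGroup X] [NormedSpace ℂ X] [CompleteSpace X]

theorem apply_fourierCoeffOn {p q : ℝ} (hpq : p < q) {Y : Type*} [NormedAddCommGroup Y]
    [NormedSpace ℂ Y] [CompleteSpace Y] {h : ℝ → X} (hi : IntervalIntegrable h volume p q)
    (φ : X →L[ℂ] Y) (n : ℤ) :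
    φ (fourierCoeffOn hpq h n) = fourierCoeffOn hpq (fun s => φ (h s)) n := by
  rw [fourierCoeffOn_eq_integral, fourierCoeffOn_eq_integral, φ.map_smul_of_tower,
    ← φ.intervalIntegral_comp_comm]
  · simp only [_root_.map_smul]
  · exact hi.continuousOn_smul
      ((map_continuous (fourier (-n))).comp (AddCircle.continuous_mk' _)).continuousOn

/-- A vector-valued `C²` function vanishing to second order at the end points has Fourier
coefficients that are absolutely summable against `fourierWeight`. -/
theorem summable_fourierWeight_mul_norm_fourierCoeffOn_of_deriv2 {p q : ℝ} (hpq : p < q)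
    {h h' h'' : ℝ → X} (hh : ∀ s ∈ Icc p q, HasDerivAt h (h' s) s)
    (hh' : ∀ s ∈ Icc p q, HasDerivAt h' (h'' s) s) (hh'' : ContinuousOn h'' (Icc p q))
    (hb : h p = h q) (hb' : h' p = h' q) :
    Summable fun n => fourierWeight n * ‖fourierCoeffOn hpq h n‖ := by
  have hqp : 0 < q - p := sub_pos.2 hpq
  obtain ⟨C, hC⟩ := isCompact_Icc.exists_bound_of_continuousOn hh''
  have hC0 : 0 ≤ C := (norm_nonneg _).trans (hC p (left_mem_Icc.2 hpq.le))
  have hcont : ContinuousOn h (Icc p q) := fun s hs => (hh s hs).continuousAt.continuousWithinAt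
  have hcont' : ContinuousOn h' (Icc p q) := fun s hs => (hh' s hs).continuousAt.continuousWithinAt
  set K := (q - p) / (2 * Real.pi) with hK
  have hKpos : 0 < K := by positivity
  have hdecay : ∀ n : ℤ, n ≠ 0 → ‖fourierCoeffOn hpq h n‖ ≤ K ^ 2 * C / |(n : ℝ)| ^ 2 := by
    intro n hn
    refine NormedSpace.norm_le_dual_bound ℂ _ (by positivity) fun φ => ?_
    have hn' : 0 < |(n : ℝ)| := abs_pos.2 (by exact_mod_cast hn)
    rw [apply_fourierCoeffOn hpq ((uIcc_of_le hpq.le).symm ▸ hcont).intervalIntegrable,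
      norm_fourierCoeffOn_eq_of_hasDerivAt hpq (g := fun s => φ (h s)) (g' := fun s => φ (h' s))
        (fun s hs => (φ.restrictScalars ℝ).hasFDerivAt.comp_hasDerivAt s (hh s hs))
        (φ.continuous.comp_continuousOn hcont') (by rw [hb]) hn,
      norm_fourierCoeffOn_eq_of_hasDerivAt hpq (g := fun s => φ (h' s)) (g' := fun s => φ (h'' s))
        (fun s hs => (φ.restrictScalars ℝ).hasFDerivAt.comp_hasDerivAt s (hh' s hs))
        (φ.continuous.comp_continuousOn hh'') (by rw [hb']) hn]
    have hle : ‖fourierCoeffOn hpq (fun s => φ (h'' s)) n‖ ≤ ‖φ‖ * C :=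
      norm_fourierCoeffOn_le hpq (fun s hs => (φ.le_opNorm _).trans (by gcongr; exact hC s hs)) n
    calc _ = K ^ 2 * ‖fourierCoeffOn hpq (fun s => φ (h'' s)) n‖ / |(n : ℝ)| ^ 2 := by
          rw [← hK]; ring
      _ ≤ K ^ 2 * (‖φ‖ * C) / |(n : ℝ)| ^ 2 := by gcongr
      _ = _ := by ring
  refine (((Real.summable_one_div_int_pow (p := 2)).2 (by norm_num)).add
    summable_fourierWeight_sq_div |>.mul_left (K ^ 2 * C)).of_norm_bounded_eventually ?_
  filter_upwards [(Set.finite_singleton (0 : ℤ)).compl_mem_cofinite] with n hn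
  have hn' : n ≠ 0 := by simpa using hn
  have hw := one_le_fourierWeight n
  have hn0 : 0 < |(n : ℝ)| := abs_pos.2 (by exact_mod_cast hn')
  rw [Real.norm_of_nonneg (by positivity)]
  calc fourierWeight n * ‖fourierCoeffOn hpq h n‖
      ≤ fourierWeight n ^ 2 * (K ^ 2 * C / |(n : ℝ)| ^ 2) := by
        gcongr
        · nlinarith
        · exact hdecay n hn'
    _ = K ^ 2 * C * ((fourierWeight n / |(n : ℝ)|) ^ 2) := by ring
    _ ≤ _ := by
        gcongr
        have : 0 ≤ 1 / (n : ℝ) ^ 2 := by positivity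
        linarith

end FourierDecay

/-! ### Mixing Gaussian measures from eigenvector fields -/

section Construction

open Set

variable {X : Type*} [NormedAddCommGroup X] [NormedSpace ℂ X]

/-- The real part of a complex functional, as a real functional. -/
noncomputable def reDual (φ : StrongDual ℂ X) : StrongDual ℝ X :=
  Complex.reCLM.comp (φ.restrictScalars ℝ)

theorem reDual_apply (φ : StrongDual ℂ X) (x : X) : reDual φ x = (φ x).re := rfl

theorem exists_reDual_eq (L : StrongDual ℝ X) : ∃ φ : StrongDual ℂ X, reDual φ = L :=
  ⟨L.extendRCLike, ContinuousLinearMap.ext fun x => StrongDual.re_extendRCLike_apply (𝕜 := ℂ) L x⟩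

theorem reDual_sq_add_reDual_I_smul_sq (φ : StrongDual ℂ X) (x : X) :
    reDual φ x ^ 2 + reDual φ (Complex.I • x) ^ 2 = ‖φ x‖ ^ 2 := by
  rw [reDual_apply, reDual_apply, _root_.map_smul, ← Complex.normSq_eq_norm_sq,
    Complex.normSq_apply]
  simp
  ring

theorem integral_norm_add_sq_le {p q : ℝ} (hpq : p ≤ q) {g₁ g₂ : ℝ → ℂ}
    (h₁ : ContinuousOn g₁ (Icc p q)) (h₂ : ContinuousOn g₂ (Icc p q)) :
    ∫ s in p..q, ‖g₁ s + g₂ s‖ ^ 2 ≤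
      2 * ((∫ s in p..q, ‖g₁ s‖ ^ 2) + ∫ s in p..q, ‖g₂ s‖ ^ 2) := by
  rw [← uIcc_of_le hpq] at h₁ h₂
  have hi₁ : IntervalIntegrable (fun s => ‖g₁ s‖ ^ 2) volume p q :=
    (h₁.norm.pow 2).intervalIntegrable
  have hi₂ : IntervalIntegrable (fun s => ‖g₂ s‖ ^ 2) volume p q :=
    (h₂.norm.pow 2).intervalIntegrable
  rw [← intervalIntegral.integral_add hi₁ hi₂, ← intervalIntegral.integral_const_mul]
  refine intervalIntegral.integral_mono_on hpq ((h₁.add h₂).norm.pow 2).intervalIntegrable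
    ((hi₁.add hi₂).const_mul 2) fun s _ => ?_
  have h := norm_add_le (g₁ s) (g₂ s)
  have h0 := norm_nonneg (g₁ s + g₂ s)
  nlinarith [sq_nonneg (‖g₁ s‖ - ‖g₂ s‖)]

variable [CompleteSpace X] [SecondCountableTopology X] [MeasurableSpace X] [BorelSpace X]

/-- The Gaussian measure with covariance `φ ↦ ∑ₘ |φ(vₘ)|²`, the law of a random series
`∑ₘ γₘ vₘ` with independent complex Gaussian coefficients. The real and imaginary parts of `γₘ` are
encoded as separate real coefficients of `vₘ` and `i vₘ`. -/
theorem exists_complex_gaussian {N : Type*} [Countable N] {v : N → X} {ρ : N → ℝ}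
    (hρ1 : ∀ m, 1 ≤ ρ m) (hρs : Summable fun m => (ρ m ^ 8)⁻¹)
    (hv : ∀ a : N → ℂ, (∀ m, ‖a m‖ ≤ ρ m) → Summable fun m => a m • v m)
    (hd : ∀ φ : StrongDual ℂ X, (∀ m, φ (v m) = 0) → φ = 0) :
    ∃ μ : Measure X, IsProbabilityMeasure μ ∧ HasFullSupport μ ∧
      ∀ φ : StrongDual ℂ X, (Summable fun m => ‖φ (v m)‖ ^ 2) ∧
        charFunDual μ (reDual φ) = Complex.exp ((-(1 / 2) * ∑' m, ‖φ (v m)‖ ^ 2 : ℝ)) := by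
  obtain ⟨w, hwl, hwr⟩ : ∃ w : N ⊕ N → X, (∀ m, w (Sum.inl m) = v m) ∧
      ∀ m, w (Sum.inr m) = Complex.I • v m :=
    ⟨Sum.elim v fun m => Complex.I • v m, fun _ => rfl, fun _ => rfl⟩
  have hσ1 : ∀ m, 1 ≤ Sum.elim ρ ρ m := by rintro (m | m) <;> exact hρ1 m
  have hσs : Summable fun m => (Sum.elim ρ ρ m ^ 8)⁻¹ := Summable.sum _ hρs hρs
  have hw : ∀ a : N ⊕ N → ℝ, (∀ m, |a m| ≤ Sum.elim ρ ρ m) → Summable fun m => a m • w m := by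
    intro a ha
    refine Summable.sum _ ((hv (fun m => a (Sum.inl m)) fun m => ?_).congr fun m => ?_)
      ((hv (fun m => a (Sum.inr m) * Complex.I) fun m => ?_).congr fun m => ?_)
    · rw [Complex.norm_real]; exact ha (Sum.inl m)
    · rw [Function.comp_apply, hwl, Complex.coe_smul]
    · rw [norm_mul, Complex.norm_I, mul_one, Complex.norm_real]; exact ha (Sum.inr m)
    · rw [Function.comp_apply, hwr, mul_smul, Complex.coe_smul]
  obtain ⟨μ, hμp, hμ⟩ := exists_measure_charFunDual_eq hσ1 hσs hw
  refine ⟨μ, hμp, hasFullSupport_of_charFunDual_eq hσ1 hσs hw hμ ?_, fun φ => ?_⟩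
  · refine dense_span_of_forall_dual_eq_zero fun L hL => ?_
    obtain ⟨φ, rfl⟩ := exists_reDual_eq L
    have hφ : φ = 0 := by
      refine hd φ fun m => ?_
      have h1 := hL _ ⟨Sum.inl m, rfl⟩
      have h2 := hL _ ⟨Sum.inr m, rfl⟩
      have h3 := reDual_sq_add_reDual_I_smul_sq φ (v m)
      rw [hwl] at h1
      rw [hwr] at h2
      rw [h1, h2] at h3
      rw [← norm_eq_zero, ← sq_eq_zero_iff, ← h3]
      norm_num
    rw [hφ]
    ext x
    simp [reDual_apply]
  · have hs : Summable fun m => reDual φ (w m) := by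
      have := (reDual φ).summable (hw (fun _ => 1) fun m => by simpa using hσ1 m)
      simpa using this
    have hs2 := summable_sq_of_summable hs
    have hl := hs2.comp_injective Sum.inl_injective
    have hr := hs2.comp_injective Sum.inr_injective
    have heq : ∑' m, reDual φ (w m) ^ 2 = ∑' m, ‖φ (v m)‖ ^ 2 := by
      rw [(hl.hasSum.sum hr.hasSum).tsum_eq, ← hl.tsum_add hr]
      refine tsum_congr fun m => ?_
      simp only [Function.comp_apply, hwl, hwr, reDual_sq_add_reDual_I_smul_sq]
    refine ⟨(hl.add hr).congr fun m => ?_, by rw [hμ, heq]⟩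
    simp only [Function.comp_apply, hwl, hwr, reDual_sq_add_reDual_I_smul_sq]

/-- A strongly mixing Gaussian measure of full support, built from countably many `X`-valued
functions `h k` on intervals `[p k, q k]` whose values `h k s` are eigenvectors of `T t` for the
eigenvalue `exp (i s t)`: it is the law of `∑ ε k γ k n v k n` with complex Gaussians `γ k n`, where
`v k n` are the Fourier coefficients of `h k`. By Parseval's identity the variance of a functional
`φ` is a weighted sum of the squared `L²` norms of `φ ∘ h k`. Passing from `φ` to `φ ∘ T t`
multiplies `φ ∘ h k` by a unimodular function, whence invariance, and mixing is the Riemann–Lebesgue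
lemma. The weights `r k` and `fourierWeight` dominate the growth of the Gaussian coefficients in
`k` and `n`. -/
theorem exists_mixing_measure {ι : Type*} [Countable ι] {T : ℝ≥0 → X →L[ℂ] X} {p q : ι → ℝ}
    (hpq : ∀ k, p k < q k) {h : ι → ℝ → X}
    (hint : ∀ k, IntervalIntegrable (h k) volume (p k) (q k))
    (hcont : ∀ (φ : StrongDual ℂ X) k, ContinuousOn (fun s => φ (h k s)) (Icc (p k) (q k)))
    (heig : ∀ k, ∀ s ∈ Icc (p k) (q k), ∀ t : ℝ≥0,
      T t (h k s) = Complex.exp (Complex.I * s * (t : ℝ)) • h k s)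
    (hdense : ∀ φ : StrongDual ℂ X, (∀ k n, φ (fourierCoeffOn (hpq k) (h k) n) = 0) → φ = 0)
    {ε r : ι → ℝ} (hε : ∀ k, 0 < ε k) (hr : ∀ k, 1 ≤ r k) (hrs : Summable fun k => (r k ^ 8)⁻¹)
    (hsum : ∀ a : ι × ℤ → ℂ, (∀ m, ‖a m‖ ≤ 1) → Summable fun m : ι × ℤ =>
      a m • (ε m.1 * (r m.1 * fourierWeight m.2)) • fourierCoeffOn (hpq m.1) (h m.1) m.2) :
    ∃ μ : Measure X, IsProbabilityMeasure μ ∧ IsInvariant T μ ∧ IsStronglyMixing T μ ∧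
      HasFullSupport μ := by
  obtain ⟨v, hv⟩ : ∃ v : ι × ℤ → X,
      ∀ m, v m = ε m.1 • fourierCoeffOn (hpq m.1) (h m.1) m.2 := ⟨_, fun _ => rfl⟩
  obtain ⟨ρ, hρ⟩ : ∃ ρ : ι × ℤ → ℝ, ∀ m, ρ m = r m.1 * fourierWeight m.2 := ⟨_, fun _ => rfl⟩
  have hρ1 : ∀ m, 1 ≤ ρ m := fun m => by
    rw [hρ]; exact one_le_mul_of_one_le_of_one_le (hr _) (one_le_fourierWeight _)
  have hρs : Summable fun m => (ρ m ^ 8)⁻¹ := by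
    refine (hrs.mul_of_nonneg summable_inv_fourierWeight_pow_eight (fun k => ?_)
      fun n => ?_).congr fun m => ?_
    · have := hr k
      positivity
    · have := one_le_fourierWeight n
      positivity
    · simp only [hρ, mul_pow, mul_inv]
  have hvs : ∀ a : ι × ℤ → ℂ, (∀ m, ‖a m‖ ≤ ρ m) → Summable fun m => a m • v m := by
    intro a ha
    refine (hsum (fun m => a m / (ρ m : ℂ)) fun m => ?_).congr fun m => ?_
    · have h0 := zero_lt_one.trans_le (hρ1 m)
      rw [norm_div, Complex.norm_real, Real.norm_of_nonneg h0.le]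
      exact (div_le_one h0).2 (ha m)
    · have h0 := (zero_lt_one.trans_le (hρ1 m)).ne'
      rw [← hρ, mul_comm (ε m.1), mul_smul, ← hv, ← Complex.coe_smul, smul_smul,
        div_mul_cancel₀ _ (Complex.ofReal_ne_zero.2 h0)]
  obtain ⟨μ, hμp, hfull, hμ⟩ := exists_complex_gaussian hρ1 hρs hvs fun φ hφ => by
    refine hdense φ fun k n => ?_
    have h1 := hφ (k, n)
    rw [hv, φ.map_smul_of_tower, smul_eq_zero] at h1
    exact h1.resolve_left (hε k).ne'
  -- The contribution of the block `k` to the variance of `φ`.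
  set V : StrongDual ℂ X → ι → ℝ := fun φ k =>
    ε k ^ 2 * ((q k - p k)⁻¹ * ∫ s in p k..q k, ‖φ (h k s)‖ ^ 2) with hV
  have hcov : ∀ φ : StrongDual ℂ X, HasSum (V φ) (∑' m, ‖φ (v m)‖ ^ 2) := by
    intro φ
    refine (hμ φ).1.hasSum.prod_fiberwise fun k => ?_
    have hP := (hasSum_sq_fourierCoeffOn (hpq k)
      (memLp_two_Ioc_of_continuousOn (hcont φ k))).mul_left (ε k ^ 2)
    have hfun : (fun n => ‖φ (v (k, n))‖ ^ 2) =
        fun n => ε k ^ 2 * ‖fourierCoeffOn (hpq k) (fun s => φ (h k s)) n‖ ^ 2 := funext fun n => ?_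
    · rw [← hfun] at hP
      exact hP
    rw [hv, φ.map_smul_of_tower, norm_smul, mul_pow, Real.norm_eq_abs, sq_abs,
      apply_fourierCoeffOn (hpq k) (hint k)]
  have hchar : ∀ φ : StrongDual ℂ X,
      charFunDual μ (reDual φ) = Complex.exp ((-(1 / 2) * ∑' k, V φ k : ℝ)) := fun φ => by
    rw [(hμ φ).2, (hcov φ).tsum_eq]
  have hVT : ∀ (φ : StrongDual ℂ X) (t : ℝ≥0), V (φ.comp (T t)) = V φ := by
    intro φ t
    ext k
    simp only [hV]
    congr 2
    refine intervalIntegral.integral_congr fun s hs => ?_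
    rw [uIcc_of_le (hpq k).le] at hs
    have h1 : ‖Complex.exp (Complex.I * s * (t : ℝ))‖ = 1 := by
      rw [show Complex.I * s * (t : ℝ) = ((s * t : ℝ) : ℂ) * Complex.I by push_cast; ring,
        Complex.norm_exp_ofReal_mul_I]
    simp only [ContinuousLinearMap.comp_apply, heig k s hs t, _root_.map_smul, norm_smul, h1,
      one_mul]
  have hinv : IsInvariant T μ := by
    intro t
    refine ⟨(T t).continuous.measurable, ?_⟩
    have : IsProbabilityMeasure (μ.map (T t)) :=
      Measure.isProbabilityMeasure_map (T t).continuous.measurable.aemeasurable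
    refine Measure.ext_of_charFunDual (funext fun L => ?_)
    obtain ⟨φ, rfl⟩ := exists_reDual_eq L
    have hmap : charFunDual (μ.map (T t)) (reDual φ) = charFunDual μ (reDual (φ.comp (T t))) :=
      charFunDual_map ((T t).restrictScalars ℝ) (reDual φ)
    rw [hmap, hchar, hchar, hVT]
  have hV0 : ∀ φ k, 0 ≤ V φ k := fun φ k =>
    mul_nonneg (sq_nonneg _) (mul_nonneg (inv_nonneg.2 (sub_pos.2 (hpq k)).le)
      (intervalIntegral.integral_nonneg (hpq k).le fun _ _ => sq_nonneg _))
  have hmix : IsStronglyMixing T μ := by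
    refine isStronglyMixing_of_tendsto_charFunDual hinv fun L L' => ?_
    obtain ⟨φ, rfl⟩ := exists_reDual_eq L
    obtain ⟨χ, rfl⟩ := exists_reDual_eq L'
    have hadd : ∀ t, reDual φ + (reDual χ).comp ((T t).restrictScalars ℝ) =
        reDual (φ + χ.comp (T t)) := fun t => by
      ext x; simp [reDual_apply]
    simp only [hadd, hchar]
    rw [← Complex.exp_add, ← Complex.ofReal_add, ← mul_add,
      ← (hcov φ).summable.tsum_add (hcov χ).summable]
    have hc : Continuous fun x : ℝ => Complex.exp ((-(1 / 2) * x : ℝ)) := by fun_prop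
    refine (hc.tendsto _).comp ?_
    refine tendsto_tsum_of_dominated_convergence (bound := fun k => 2 * (V φ k + V χ k))
      (((hcov φ).summable.add (hcov χ).summable).mul_left 2) (fun k => ?_)
      (Eventually.of_forall fun t k => ?_)
    · have hlim := ((tendsto_integral_norm_add_exp_mul_sq (hpq k).le (hcont φ k)
        (hcont χ k)).const_mul (q k - p k)⁻¹).const_mul (ε k ^ 2)
      simp only [hV, ← mul_add]
      refine hlim.congr fun t => ?_
      congr 2
      refine intervalIntegral.integral_congr fun s hs => ?_
      rw [uIcc_of_le (hpq k).le] at hs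
      simp [heig k s hs t]
    · rw [Real.norm_of_nonneg (hV0 _ _), ← hVT χ t]
      have hle := integral_norm_add_sq_le (hpq k).le (hcont φ k) (hcont (χ.comp (T t)) k)
      have hqp := sub_pos.2 (hpq k)
      calc V (φ + χ.comp (T t)) k ≤ ε k ^ 2 * ((q k - p k)⁻¹ *
            (2 * ((∫ s in p k..q k, ‖φ (h k s)‖ ^ 2) +
              ∫ s in p k..q k, ‖(χ.comp (T t)) (h k s)‖ ^ 2))) := by
            simp only [hV]
            gcongr
            exact hle
        _ = 2 * (V φ k + V (χ.comp (T t)) k) := by simp only [hV]; ring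
  exact ⟨μ, hμp, hinv, hmix, hfull⟩

end Construction

/-! ### Cutoffs, scaling, and the choice of countably many blocks -/

section Cutoff

open Set

/-- A polynomial cutoff on `[p, q]`, vanishing to second order at the end points. -/
noncomputable def cutoff (p q s : ℝ) : ℝ := ((s - p) * (q - s)) ^ 2

theorem contDiff_cutoff (p q : ℝ) {n : WithTop ℕ∞} : ContDiff ℝ n (cutoff p q) := by
  unfold cutoff; fun_prop

theorem cutoff_left (p q : ℝ) : cutoff p q p = 0 := by simp [cutoff]

theorem cutoff_right (p q : ℝ) : cutoff p q q = 0 := by simp [cutoff]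

theorem hasDerivAt_cutoff (p q s : ℝ) :
    HasDerivAt (cutoff p q) (2 * ((s - p) * (q - s)) * ((q - s) - (s - p))) s := by
  have h := (((hasDerivAt_id s).sub_const p).mul ((hasDerivAt_id s).const_sub q)).pow 2
  refine h.congr_deriv ?_
  simp only [Pi.mul_apply, id, Nat.cast_ofNat, Nat.add_one_sub_one, pow_one]
  ring

theorem cutoff_ne_zero {p q s : ℝ} (hs : s ∈ Ioo p q) : cutoff p q s ≠ 0 := by
  have h1 := sub_pos.2 hs.1
  have h2 := sub_pos.2 hs.2
  exact (pow_pos (mul_pos h1 h2) 2).ne'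

theorem LocallyBoundedOn.exists_norm_le {X : Type*} [NormedAddCommGroup X] {f : ℝ → X}
    {I K : Set ℝ} (hf : LocallyBoundedOn f I) (hK : IsCompact K) (hKI : K ⊆ I) :
    ∃ C, ∀ s ∈ K, ‖f s‖ ≤ C := by
  have h : Bornology.IsBounded (f '' K) := by
    refine hK.induction_on (p := fun S => Bornology.IsBounded (f '' S)) (by simp)
      (fun S S' hS h => h.subset (image_mono hS))
      (fun S S' h h' => by rw [image_union]; exact h.union h') fun s hs => ?_
    obtain ⟨U, hU, hb⟩ := hf s (hKI hs)
    exact ⟨K ∩ U, inter_mem_nhdsWithin K hU,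
      hb.subset (image_mono fun r hr => ⟨hr.2, hKI hr.1⟩)⟩
  obtain ⟨C, hC⟩ := h.exists_norm_le
  exact ⟨C, fun s hs => hC _ (mem_image_of_mem f hs)⟩

variable {X : Type*} [NormedAddCommGroup X] [NormedSpace ℂ X] {I : Set ℝ} {p q : ℝ}

theorem contDiffOn_cutoff_smul {f : ℝ → X} {n : WithTop ℕ∞} (hf : ContDiffOn ℝ n f I) :
    ContDiffOn ℝ n (fun s => cutoff p q s • f s) (interior I) :=
  (contDiff_cutoff p q).contDiffOn.smul (hf.mono interior_subset)

/-- In the weakly `C¹` case, the Fourier coefficients are weakly absolutely summable against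
`fourierWeight`. -/
theorem summable_fourierWeight_of_contDiffOn_one (hpq : p < q) (hsub : Icc p q ⊆ interior I)
    {g : ℝ → ℂ} (hg : ContDiffOn ℝ 1 g I) :
    Summable fun n => fourierWeight n * ‖fourierCoeffOn hpq (fun s => cutoff p q s • g s) n‖ := by
  have hc := contDiffOn_cutoff_smul (p := p) (q := q) hg
  refine summable_fourierWeight_mul_norm_fourierCoeffOn hpq
    (g' := deriv fun s => cutoff p q s • g s) (fun s hs => ?_)
    ((hc.continuousOn_deriv_of_isOpen isOpen_interior le_rfl).mono hsub) ?_
  · exact ((hc.differentiableOn one_ne_zero).differentiableAt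
      (isOpen_interior.mem_nhds (hsub hs))).hasDerivAt
  · simp only [cutoff_left, cutoff_right, zero_smul]

theorem intervalIntegrable_cutoff_smul [SecondCountableTopology X] [MeasurableSpace X]
    [BorelSpace X] {f : ℝ → X} (hI : I.OrdConnected) (hb : LocallyBoundedOn f I)
    (hm : Measurable fun s : I => f s) (hpq : p < q) (hsub : Icc p q ⊆ interior I) :
    IntervalIntegrable (fun s => cutoff p q s • f s) volume p q := by
  have hsub' := hsub.trans interior_subset
  obtain ⟨C, hC⟩ := hb.exists_norm_le isCompact_Icc hsub'
  have hfm : AEStronglyMeasurable f (volume.restrict (Ioc p q)) :=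
    ((aemeasurable_restrict_of_measurable_subtype hI.measurableSet hm).mono_measure
      (Measure.restrict_mono (Ioc_subset_Icc_self.trans hsub') le_rfl)).aestronglyMeasurable
  have hfi : IntervalIntegrable f volume p q := by
    rw [intervalIntegrable_iff_integrableOn_Ioc_of_le hpq.le]
    refine Integrable.of_bound hfm C ?_
    exact (ae_restrict_iff' measurableSet_Ioc).2
      (Eventually.of_forall fun s hs => hC s (Ioc_subset_Icc_self hs))
  exact hfi.continuousOn_smul (contDiff_cutoff p q (n := 0)).continuous.continuousOn

variable [CompleteSpace X]

/-- In the `C²` case, the Fourier coefficients are absolutely summable against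
`fourierWeight`. -/
theorem summable_fourierWeight_of_contDiffOn_two (hpq : p < q) (hsub : Icc p q ⊆ interior I)
    {f : ℝ → X} (hf : ContDiffOn ℝ 2 f I) :
    Summable fun n => fourierWeight n * ‖fourierCoeffOn hpq (fun s => cutoff p q s • f s) n‖ := by
  have hc := contDiffOn_cutoff_smul (p := p) (q := q) hf
  have hc' : ContDiffOn ℝ 1 (deriv fun s => cutoff p q s • f s) (interior I) :=
    hc.deriv_of_isOpen isOpen_interior (by norm_num)
  have hzero : ∀ s ∈ Icc p q, cutoff p q s = 0 → 2 * ((s - p) * (q - s)) * ((q - s) - (s - p)) = 0 →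
      deriv (fun s => cutoff p q s • f s) s = 0 := by
    intro s hs h0 h1
    have hfs := ((hf.mono interior_subset).differentiableOn two_ne_zero).differentiableAt
      (isOpen_interior.mem_nhds (hsub hs))
    have h := (hasDerivAt_cutoff p q s).smul hfs.hasDerivAt
    rw [h0, h1, zero_smul, zero_smul, add_zero] at h
    exact h.deriv
  refine summable_fourierWeight_mul_norm_fourierCoeffOn_of_deriv2 hpq
    (h' := deriv fun s => cutoff p q s • f s) (h'' := deriv (deriv fun s => cutoff p q s • f s))
    (fun s hs => ?_) (fun s hs => ?_)
    ((hc'.continuousOn_deriv_of_isOpen isOpen_interior le_rfl).mono hsub) ?_ ?_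
  · exact ((hc.differentiableOn two_ne_zero).differentiableAt
      (isOpen_interior.mem_nhds (hsub hs))).hasDerivAt
  · exact ((hc'.differentiableOn one_ne_zero).differentiableAt
      (isOpen_interior.mem_nhds (hsub hs))).hasDerivAt
  · simp only [cutoff_left, cutoff_right, zero_smul]
  · rw [hzero p (left_mem_Icc.2 hpq.le) (cutoff_left p q) (by ring),
      hzero q (right_mem_Icc.2 hpq.le) (cutoff_right p q) (by ring)]

/-- By Parseval's identity, a functional annihilating all Fourier coefficients annihilates the
function itself. -/
theorem apply_eq_zero_of_forall_fourierCoeffOn (hpq : p < q) {f : ℝ → X}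
    (hint : IntervalIntegrable (fun s => cutoff p q s • f s) volume p q) {φ : StrongDual ℂ X}
    (hcont : ContinuousOn (fun s => φ (cutoff p q s • f s)) (Icc p q))
    (hφ : ∀ n, φ (fourierCoeffOn hpq (fun s => cutoff p q s • f s) n) = 0) {s : ℝ}
    (hs : s ∈ Ioo p q) : φ (f s) = 0 := by
  have hP := hasSum_sq_fourierCoeffOn hpq (memLp_two_Ioc_of_continuousOn hcont)
  simp only [← apply_fourierCoeffOn hpq hint φ, hφ] at hP
  have hP0 : HasSum (fun _ : ℤ => ‖(0 : ℂ)‖ ^ 2) (0 : ℝ) := by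
    simp
  have h0 := hP.unique hP0
  rw [smul_eq_zero] at h0
  have h1 := h0.resolve_left (inv_ne_zero (sub_pos.2 hpq).ne')
  have hc2 : ContinuousOn (fun s => ‖φ (cutoff p q s • f s)‖ ^ 2) (Icc p q) := hcont.norm.pow 2
  by_contra hne
  have hpos := intervalIntegral.integral_pos hpq hc2 (fun _ _ => sq_nonneg _)
    ⟨s, Ioo_subset_Icc_self hs, by
      rw [φ.map_smul_of_tower]
      exact pow_pos (norm_pos_iff.2 (smul_ne_zero (cutoff_ne_zero hs) hne)) 2⟩
  exact hpos.ne' h1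

end Cutoff

section Scaling

variable {X : Type*} [NormedAddCommGroup X] [NormedSpace ℂ X]

theorem exists_pos_summable_mul {ι : Type*} [Countable ι] {C : ι → ℝ} (hC : ∀ k, 0 ≤ C k) :
    ∃ ε : ι → ℝ, (∀ k, 0 < ε k) ∧ Summable fun k => ε k * C k := by
  obtain ⟨δ, hδ, c, hc, -⟩ := NNReal.exists_pos_sum_of_countable one_ne_zero ι
  refine ⟨fun k => δ k / (C k + 1), fun k => ?_, ?_⟩
  · have := hC k
    exact div_pos (hδ k) (by linarith)
  · refine Summable.of_nonneg_of_le (fun k => ?_) (fun k => ?_) (NNReal.summable_coe.2 hc.summable)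
    · have := hC k
      positivity
    · have := hC k
      rw [div_mul_eq_mul_div, div_le_iff₀ (by linarith)]
      have := (δ k).2
      change (δ k : ℝ) * C k ≤ δ k * (C k + 1)
      gcongr
      linarith

theorem exists_pos_summable_smul_of_summable_norm [CompleteSpace X] {ι κ : Type*} [Countable ι]
    {u : ι × κ → X} (hu : ∀ k, Summable fun n => ‖u (k, n)‖) :
    ∃ ε : ι → ℝ, (∀ k, 0 < ε k) ∧ ∀ a : ι × κ → ℂ, (∀ m, ‖a m‖ ≤ 1) →
      Summable fun m => a m • ε m.1 • u m := by
  obtain ⟨ε, hε, hs⟩ := exists_pos_summable_mul (C := fun k => ∑' n, ‖u (k, n)‖)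
    fun k => tsum_nonneg fun _ => norm_nonneg _
  refine ⟨ε, hε, fun a ha => ?_⟩
  have h : Summable fun m : ι × κ => ε m.1 * ‖u m‖ := by
    refine (summable_prod_of_nonneg (f := fun m : ι × κ => ε m.1 * ‖u m‖)
      fun m => mul_nonneg (hε m.1).le (norm_nonneg (u m))).2 ⟨fun k => (hu k).mul_left (ε k), ?_⟩
    exact hs.congr fun k => tsum_mul_left.symm
  refine h.of_norm_bounded fun m => ?_
  rw [norm_smul, norm_smul, Real.norm_of_nonneg (hε m.1).le]
  exact mul_le_of_le_one_left (mul_nonneg (hε m.1).le (norm_nonneg (u m))) (ha m)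

theorem exists_pos_multiplierBounded {ι κ : Type*} [Countable ι] {u : ι × κ → X}
    (hu : ∀ k, ∃ C, MultiplierBounded (fun n => u (k, n)) C) :
    ∃ ε : ι → ℝ, (∀ k, 0 < ε k) ∧ ∃ C, MultiplierBounded (fun m : ι × κ => ε m.1 • u m) C := by
  classical
  choose C hC using hu
  obtain ⟨ε, hε, hs⟩ := exists_pos_summable_mul fun k => (hC k).nonneg
  refine ⟨ε, hε, ∑' k, ε k * C k, fun F a ha => ?_⟩
  have hF : F ⊆ F.image Prod.fst ×ˢ F.image Prod.snd := Finset.subset_product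
  -- Coefficients outside `F` are set to zero, so that the sum runs over a rectangle.
  set b : ι × κ → ℂ := fun m => if m ∈ F then a m else 0 with hb
  have hb1 : ∀ m, ‖b m‖ ≤ 1 := fun m => by
    simp only [hb]; split_ifs
    · exact ha m
    · simp
  have h1 : ∑ m ∈ F, a m • ε m.1 • u m =
      ∑ m ∈ F.image Prod.fst ×ˢ F.image Prod.snd, b m • ε m.1 • u m := by
    rw [← Finset.sum_subset hF fun m _ hm => by simp [hb, hm]]
    exact Finset.sum_congr rfl fun m hm => by simp [hb, hm]
  rw [h1, Finset.sum_product]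
  refine (norm_sum_le _ _).trans (le_trans (Finset.sum_le_sum fun k _ => ?_)
    (hs.sum_le_tsum (F.image Prod.fst) fun k _ => mul_nonneg (hε k).le (hC k).nonneg))
  have h2 : ∑ n ∈ F.image Prod.snd, b (k, n) • ε k • u (k, n) =
      ε k • ∑ n ∈ F.image Prod.snd, b (k, n) • u (k, n) := by
    rw [Finset.smul_sum]
    exact Finset.sum_congr rfl fun n _ => smul_comm _ _ _
  rw [h2, norm_smul, Real.norm_of_nonneg (hε k).le]
  have := (hε k).le
  gcongr
  exact hC k _ _ fun n => hb1 (k, n)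

end Scaling

theorem exists_countable_range_subset_closure {α X : Type*} [TopologicalSpace X]
    [SecondCountableTopology X] (F : α → X) :
    ∃ D : Set α, D.Countable ∧ Set.range F ⊆ closure (F '' D) := by
  obtain ⟨s, hs, hd⟩ := TopologicalSpace.exists_countable_dense (Set.range F)
  refine ⟨(fun y : Set.range F => y.2.choose) '' s, hs.image _, ?_⟩
  have himg : F '' ((fun y : Set.range F => y.2.choose) '' s) = Subtype.val '' s := by
    rw [Set.image_image]
    exact Set.image_congr fun y _ => y.2.choose_spec
  rw [himg]
  intro y hy
  exact closure_subtype.1 (hd ⟨y, hy⟩)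

end SemigroupMixing

open SemigroupMixing in
theorem corollary2p2 {X : Type*} [NormedAddCommGroup X] [NormedSpace ℂ X] [CompleteSpace X]
    [TopologicalSpace.SeparableSpace X] [MeasurableSpace X] [BorelSpace X]
    (T : ℝ≥0 → X →L[ℂ] X) (hT : SemigroupMixing.IsC0Semigroup T)
    {Γ : Type*} (I : Γ → Set ℝ) (f : Γ → ℝ → X)
    (hI : ∀ j, (I j).OrdConnected ∧ (I j).Nontrivial)
    (hbdd : ∀ j, SemigroupMixing.LocallyBoundedOn (f j) (I j))
    (hmeas : ∀ j, Measurable (fun t : I j => f j t))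
    (heig : ∀ j, ∀ t ∈ I j, ∃ h : f j t ∈ (SemigroupMixing.generator T).domain,
      SemigroupMixing.generator T ⟨f j t, h⟩ = (Complex.I * (t : ℂ)) • f j t)
    (hspan : Dense (Submodule.span ℂ {x : X | ∃ j, ∃ t ∈ I j, x = f j t} : Set X))
    (hreg : (∀ j, ContDiffOn ℝ 2 (f j) (I j)) ∨
      (¬ SemigroupMixing.ContainsC0 X ∧
        ∀ (φ : StrongDual ℂ X) (j : Γ), ContDiffOn ℝ 1 (fun t => φ (f j t)) (I j))) :
    ∃ μ : Measure X, IsProbabilityMeasure μ ∧ SemigroupMixing.IsInvariant T μ ∧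
      SemigroupMixing.IsStronglyMixing T μ ∧ SemigroupMixing.HasFullSupport μ := by
  have : SecondCountableTopology X := UniformSpace.secondCountable_of_separable X
  -- In both cases the `f j` are weakly continuously differentiable.
  have hweak : ∀ (φ : StrongDual ℂ X) (j : Γ), ContDiffOn ℝ 1 (fun t => φ (f j t)) (I j) := by
    rcases hreg with h | h
    · exact fun φ j => (φ.restrictScalars ℝ).contDiff.comp_contDiffOn ((h j).of_le one_le_two)
    · exact h.2
  let B := {b : Γ × ℝ × ℝ // b.2.1 < b.2.2 ∧ Set.Icc b.2.1 b.2.2 ⊆ interior (I b.1)}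
  let h : B → ℝ → X := fun b s => cutoff b.1.2.1 b.1.2.2 s • f b.1.1 s
  have hint : ∀ b : B, IntervalIntegrable (h b) volume b.1.2.1 b.1.2.2 := fun b =>
    intervalIntegrable_cutoff_smul (hI _).1 (hbdd _) (hmeas _) b.2.1 b.2.2
  have hcont : ∀ (φ : StrongDual ℂ X) (b : B),
      ContinuousOn (fun s => φ (h b s)) (Set.Icc b.1.2.1 b.1.2.2) := fun φ b => by
    simp only [h, φ.map_smul_of_tower]
    exact (contDiffOn_cutoff_smul (hweak φ b.1.1)).continuousOn.mono b.2.2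
  have hTf : ∀ j, ∀ s ∈ I j, ∀ t : ℝ≥0,
      T t (f j s) = Complex.exp (Complex.I * s * (t : ℝ)) • f j s := fun j s hs t => by
    obtain ⟨hdom, hA⟩ := heig j s hs
    exact hT.apply_eq_exp_smul (hasGeneratorValue_of_generator_eq hdom hA) t
  -- A functional vanishing on all Fourier coefficients vanishes on `f j` in the interior of `I j`,
  -- hence on all of `I j` by continuity.
  have hann : ∀ φ : StrongDual ℂ X,
      (∀ (b : B) n, φ (fourierCoeffOn b.2.1 (h b) n) = 0) → φ = 0 := by
    intro φ hφ
    have hin : ∀ j, ∀ s ∈ interior (I j), φ (f j s) = 0 := by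
      intro j s hs
      obtain ⟨δ, hδ, hball⟩ := Metric.isOpen_iff.1 isOpen_interior s hs
      have hsub : Set.Icc (s - δ / 2) (s + δ / 2) ⊆ interior (I j) := fun r hr => hball (by
        rw [Metric.mem_ball, Real.dist_eq, abs_lt]
        constructor <;> linarith [hr.1, hr.2])
      let b : B := ⟨(j, s - δ / 2, s + δ / 2), by dsimp only; linarith, hsub⟩
      exact apply_eq_zero_of_forall_fourierCoeffOn b.2.1 (hint b) (hcont φ b) (hφ b)
        (s := s) ⟨by dsimp only [b]; linarith, by dsimp only [b]; linarith⟩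
    have hall : ∀ j, ∀ s ∈ I j, φ (f j s) = 0 := by
      intro j s hs
      have hne : (interior (I j)).Nonempty := by
        obtain ⟨a, ha, b, hb, hab⟩ := (hI j).2.exists_lt
        refine ⟨(a + b) / 2, mem_interior_iff_mem_nhds.2 (mem_of_superset
          (Icc_mem_nhds (by linarith) (by linarith)) ((hI j).1.out ha hb))⟩
      have hcl : s ∈ closure (interior (I j)) := by
        rw [Convex.closure_interior_eq_closure_of_nonempty_interior (𝕜 := ℝ) (hI j).1.convex hne]
        exact subset_closure hs
      have hc : ContinuousWithinAt (fun t => φ (f j t)) (interior (I j)) s :=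
        ((hweak φ j).continuousOn s hs).mono interior_subset
      have hmem := hc.mem_closure_image hcl
      have himg : (fun t => φ (f j t)) '' interior (I j) ⊆ {0} := by
        rintro _ ⟨r, hr, rfl⟩
        exact hin j r hr
      simpa using closure_mono himg hmem
    have hker : Submodule.span ℂ {x : X | ∃ j, ∃ t ∈ I j, x = f j t} ≤ φ.ker := by
      rw [Submodule.span_le]
      rintro _ ⟨j, t, ht, rfl⟩
      exact hall j t ht
    exact ContinuousLinearMap.ext fun x => congrFun
      (φ.continuous.ext_on hspan continuous_zero fun x hx => hker hx) x
  -- By separability, countably many pairs of a function and an interval suffice.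
  obtain ⟨D, hD, hDcl⟩ := exists_countable_range_subset_closure
    fun m : B × ℤ => fourierCoeffOn m.1.2.1 (h m.1) m.2
  let ι := (Prod.fst '' D : Set B)
  have : Countable ι := (hD.image _).to_subtype
  obtain ⟨e, he⟩ := exists_injective_nat ι
  have hann' : ∀ φ : StrongDual ℂ X,
      (∀ (k : ι) n, φ (fourierCoeffOn k.1.2.1 (h k.1) n) = 0) → φ = 0 := by
    intro φ hφ
    refine hann φ fun b n => ?_
    have hmem := hDcl ⟨(b, n), rfl⟩
    have hclosed : IsClosed {x | φ x = 0} := isClosed_eq φ.continuous continuous_const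
    refine hclosed.closure_subset_iff.2 ?_ hmem
    rintro _ ⟨m, hm, rfl⟩
    exact hφ ⟨m.1, m, hm, rfl⟩ m.2
  let r : ι → ℝ := fun k => e k + 1
  have hr : ∀ k, 1 ≤ r k := fun k => by simp [r]
  have hrs : Summable fun k => (r k ^ 8)⁻¹ := by
    have h8 := (summable_nat_add_iff 1).2 (Real.summable_nat_pow_inv.2 (by norm_num : 1 < 8))
    exact (h8.comp_injective he).congr fun k => by simp [r]
  let u : ι × ℤ → X := fun m =>
    (r m.1 * fourierWeight m.2) • fourierCoeffOn m.1.1.2.1 (h m.1.1) m.2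
  have hnorm : ∀ m : ι × ℤ, 0 ≤ r m.1 * fourierWeight m.2 := fun m =>
    mul_nonneg (zero_le_one.trans (hr _)) (zero_le_one.trans (one_le_fourierWeight _))
  have hex : ∃ ε : ι → ℝ, (∀ k, 0 < ε k) ∧ ∀ a : ι × ℤ → ℂ, (∀ m, ‖a m‖ ≤ 1) →
      Summable fun m => a m • ε m.1 • u m := by
    rcases hreg with h2 | ⟨hc0, -⟩
    · refine exists_pos_summable_smul_of_summable_norm fun k => ?_
      refine ((summable_fourierWeight_of_contDiffOn_two k.1.2.1 k.1.2.2 (h2 _)).mul_left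
        (r k)).congr fun n => ?_
      rw [norm_smul, Real.norm_of_nonneg (hnorm (k, n)), mul_assoc]
    · obtain ⟨ε, hε, C, hC⟩ := exists_pos_multiplierBounded (u := u) fun k => by
        refine exists_multiplierBounded fun φ => ?_
        refine ((summable_fourierWeight_of_contDiffOn_one k.1.2.1 k.1.2.2
          (hweak φ k.1.1.1)).mul_left (r k)).congr fun n => ?_
        simp only [u]
        rw [φ.map_smul_of_tower, norm_smul, Real.norm_of_nonneg (hnorm (k, n)), mul_assoc,
          apply_fourierCoeffOn k.1.2.1 (hint k.1)]
        simp only [h, φ.map_smul_of_tower]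
      exact ⟨ε, hε, fun a ha => hC.summable_smul hc0 a ha⟩
  obtain ⟨ε, hε, hsum⟩ := hex
  refine exists_mixing_measure (p := fun k : ι => k.1.1.2.1) (q := fun k => k.1.1.2.2)
    (h := fun k => h k.1) (fun k => k.1.2.1) (fun k => hint k.1) (fun φ k => hcont φ k.1)
    (fun k s hs t => ?_) hann' hε hr hrs fun a ha => (hsum a ha).congr fun m => ?_
  · simp only [h]
    rw [(T t).map_smul_of_tower, hTf _ s (interior_subset (k.1.2.2 hs)) t, smul_comm]
  · simp only [u, smul_smul]
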